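/- **Model.** A seller and a buyer interact for $T\ge 1$ rounds. In round $t$ the buyer has a value $v_t\in[0,1]$, the seller posts a price $p_t\in[0,1]$ and then learns only the bit $\sigma_t=\mathbf 1\{v_t\ge p_t\}$. An online algorithm is randomized and chooses $p_t$ from its own earlier prices and the earlier bits. A *stochastic buyer with fixed changing rate $\varepsilon$* has an arbitrary (possibly random) first value $v_1\in[0,1]$; then, after each round $t$, an adaptive adversary who knows $v_1,p_1,\dots,v_t,p_t$ chooses a mean-zero distribution supported in $[-\varepsilon,\varepsilon]$ from which $v_{t+1}-v_t$ is drawn, always with $v_{t+1}\in[0,1]$. Given the history through round $t$, the draw of $v_{t+1}$ is independent of the seller's randomization of $p_{t+1}$. The *revenue loss* is the expectation of $\frac1T\sum_{t=1}^T (v_t-p_t\sigma_t)$. **Theorem.** 1. (Upper bound, $\varepsilon$ unknown.) There are a family of online algorithms, one for each horizon $T$ and not depending on $\varepsilon$, and constants $C$ and $k\in\mathbb N$, such that for all $T\ge1$, all $\varepsilon\in(0,1]$ and every stochastic buyer with fixed changing rate $\varepsilon$, the revenue loss over $T$ rounds is at most $$C\,\varepsilon^{2/3}\bigl(1+\log(1/\varepsilon)\bigr)^k+C\,T^{-1/3},$$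 so it is $\tilde O(\varepsilon^{2/3})$, that is, $O(\varepsilon^{2/3})\,\mathrm{polylog}(1/\varepsilon)+o(1)$ as $T\to\infty$, uniformly in $\varepsilon$ and the buyer. 2. (Lower bound.) There is a constant $c>0$ such that for all $\varepsilon\in(0,1]$ and all $T\ge1$ with $T\varepsilon^2\le1$, and for every online algorithm (even one that is designed for these $T$ and $\varepsilon$), there is a stochastic buyer with fixed changing rate $\varepsilon$ against which its revenue loss over $T$ rounds is at least $c\,\varepsilon^{2/3}$. -/

import Mathlib

open MeasureTheory ProbabilityTheory
open scoped unitInterval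

noncomputable section

namespace OnlinePricing

/-- The outcome of one round: the pair `(v, p)` of the buyer's value and the posted price,
both in `[0,1]`. Rounds are indexed by `0, 1, 2, …`. -/
abbrev Round : Type := I × I

/-- The complete history of the rounds `0, …, n`. -/
abbrev History (n : ℕ) : Type := (i : Finset.Iic n) → Round

/-- What the seller knows after the rounds `0, …, n`: in each round the price that was posted and
the binary signal `1{v ≥ p}` (`true` if the item was sold). -/
abbrev SellerHistory (n : ℕ) : Type := (i : Finset.Iic n) → I × Bool

/-- What the seller sees of a round `(v, p)`. -/
def signal (x : Round) : I × Bool := (x.2, decide (x.2 ≤ x.1))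

/-- What the seller sees of a history. -/
def observe (n : ℕ) (h : History n) : SellerHistory n := fun i => signal (h i)

lemma measurable_signal : Measurable signal := by
  refine measurable_snd.prodMk (measurable_to_bool ?_)
  have : (fun x : Round => decide (x.2 ≤ x.1)) ⁻¹' {true} = {x | x.2 ≤ x.1} := by
    ext x; simp
  rw [this]
  exact measurableSet_le measurable_snd measurable_fst

lemma measurable_observe (n : ℕ) : Measurable (observe n) :=
  measurable_pi_lambda _ fun i => measurable_signal.comp (measurable_pi_apply i)

/-- A (randomized) online pricing algorithm: a law of the first price, and for every `n` the law of
the price in round `n + 1` as a function of the seller's own earlier prices and the signals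
of the rounds `0, …, n`. -/
structure Seller where
  first : Measure I
  next : (n : ℕ) → Kernel (SellerHistory n) I
  first_prob : IsProbabilityMeasure first
  next_markov : ∀ n, IsMarkovKernel (next n)

/-- An adaptive buyer: a law of the first value, and for every `n` the law of the value in round
`n + 1` as a function of all values and all prices of the rounds `0, …, n`. -/
structure Buyer where
  first : Measure I
  next : (n : ℕ) → Kernel (History n) I
  first_prob : IsProbabilityMeasure first
  next_markov : ∀ n, IsMarkovKernel (next n)

attribute [instance] Seller.first_prob Seller.next_markov Buyer.first_prob Buyer.next_markov

/-- The stochastic environment with fixed changing rate `ε`: after every history of the rounds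
`0, …, n`, with last value `v`, the increment of the value in the next round has
a mean-zero distribution that is supported in `[-ε, ε]`. -/
def Buyer.IsStochastic (B : Buyer) (ε : ℝ) : Prop :=
  ∀ (n : ℕ) (h : History n),
    (∀ᵐ w : I ∂(B.next n h), (w : ℝ) - ((h ⟨n, by simp⟩).1 : ℝ) ∈ Set.Icc (-ε) ε) ∧
    ∫ w : I, ((w : ℝ) - ((h ⟨n, by simp⟩).1 : ℝ)) ∂(B.next n h) = 0

/-- The law of round `n + 1` given the history of the rounds `0, …, n`: the buyer draws the
value and the seller draws the price, independently given the history; the seller uses only the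
posted prices and the signals. -/
def step (S : Seller) (B : Buyer) (n : ℕ) : Kernel (History n) Round :=
  B.next n ×ₖ (S.next n).comap (observe n) (measurable_observe n)

instance (S : Seller) (B : Buyer) (n : ℕ) : IsMarkovKernel (step S B n) := by
  unfold step; infer_instance

/-- The law of the whole (infinite) play of seller `S` against buyer `B`. -/
def play (S : Seller) (B : Buyer) : Measure (ℕ → Round) :=
  Kernel.trajMeasure (X := fun _ => Round) (B.first.prod S.first) (step S B)

/-- The revenue loss `v - p · 1{v ≥ p}` of a single round. -/
def roundLoss (x : Round) : ℝ := (x.1 : ℝ) - (if x.2 ≤ x.1 then (x.2 : ℝ) else 0)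

/-- The expected (average) revenue loss over the first `T` rounds,
`E[(1 / T) ∑ t < T, (v_t - p_t 1{v_t ≥ p_t})]`. -/
def revenueLoss (S : Seller) (B : Buyer) (T : ℕ) : ℝ :=
  ∫ ω, (1 / (T : ℝ)) * ∑ t ∈ Finset.range T, roundLoss (ω t) ∂(play S B)

end OnlinePricing

end

noncomputable section

namespace OnlinePricing

open scoped ENNReal
open Preorder

/-! Upper bound. Let `g ≥ ε` with `ε² ≤ g³`; `g` occurs only in the analysis, not in the algorithm.
A phase of width `w` posts its base price for about `1/w` rounds. If the value is `O(w)` above the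
base, these rounds lose `O(1)` in total, which is also the order of the cost of the scan that ends
the phase. During the phase the value drifts by about `ε/√w`, which is at most `w` once `w³ ≥ ε²`.
So widths of order `g` are sustainable, at a loss of order `g` per round. The potential makes this
precise. Its quadratic term measures, in units of `g`, the width and the distance of the value from
the centre `base + 2 * width`; a mean-zero step raises it by at most `16 ε²/g² ≤ 16 g` on average.
The term with factor `2 / width - min round length` prepays the loss at the base price and is affine
in the value above the base. The term `14 g/w` makes narrow phases costly, and `30 * g * round`
saves up for the halving at the end of a long phase. When a phase ends, the quadratic term drops by
a multiple of `w²/g²`, up to `O(g)`, and multiples of `g/w` are released; by AM-GM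
(`three_le_sq_add`) both together pay all `O(1)` costs. Thus `PhaseState.amortized_step` charges `48
g` per round, and `g = max (ε^(2/3)) (T^(-1/3))` balances this with the initial potential `101 / g²`
spread over `T` rounds. No logarithm is needed.

Lower bound. The value is a `±η` walk from `1/2`, `η = ε/16`, frozen when it leaves the central
interval; it is run for `L ≈ ε^(-2/3)` steps before round `0`, so that every round has `L` steps
behind it. Negating the `L` steps before round `t` preserves the uniform law of the bits and
typically moves the value of that round by `D ≈ η√L ≈ ε^(2/3)`. The seller can tell the two paths
apart only by a price that is too high for one of them (`restrict_pathLaw_eq`), and such a price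
loses a constant. Without one, the two losses in round `t` add up to the gap of the values
(`le_pathLoss_add_pathLoss`). Averaging over the bits and summing over `t` counts each loss in at
most `L` windows with weight `D`; since `L * D ≤ 1/8`, the average loss is of order `D`
(`le_revenueLoss_walkBuyer`). -/

lemma measurable_roundLoss : Measurable roundLoss := by
  refine (measurable_subtype_coe.comp measurable_fst).sub (Measurable.ite ?_ ?_ measurable_const)
  · exact measurableSet_le measurable_snd measurable_fst
  · exact measurable_subtype_coe.comp measurable_snd

lemma roundLoss_nonneg (x : Round) : 0 ≤ roundLoss x := by
  unfold roundLoss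
  split_ifs with h
  · exact sub_nonneg.2 h
  · simpa using x.1.2.1

lemma roundLoss_le (x : Round) : roundLoss x ≤ x.1 := by
  unfold roundLoss
  split_ifs with h
  · linarith [x.2.2.1]
  · simp

lemma roundLoss_le_one (x : Round) : roundLoss x ≤ 1 := (roundLoss_le x).trans x.1.2.2

/-! ### The law of the play, one round at a time. -/

instance (S : Seller) (B : Buyer) : IsProbabilityMeasure (play S B) := by
  unfold play; infer_instance

lemma map_frestrictLe_play_compProd (S : Seller) (B : Buyer) (n : ℕ) :
    ((play S B).map (frestrictLe n)) ⊗ₘ step S B n =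
      (play S B).map (fun ω => (frestrictLe n ω, ω (n + 1))) :=
  Kernel.map_frestrictLe_trajMeasure_compProd_eq_map_trajMeasure

lemma map_eval_zero_play (S : Seller) (B : Buyer) :
    (play S B).map (fun ω => ω 0) = B.first.prod S.first := by
  have h : (fun ω : ℕ → Round => ω 0) =
      (fun h : History 0 => h ⟨0, by simp⟩) ∘ frestrictLe 0 := rfl
  unfold play Kernel.trajMeasure
  rw [h, ← Measure.map_map (by fun_prop) (by fun_prop), Measure.map_comp _ _ (by fun_prop),
    Kernel.traj_map_frestrictLe, Kernel.partialTraj_self, Measure.id_comp,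
    Measure.map_map (by fun_prop) (by fun_prop)]
  convert! Measure.map_id

lemma lintegral_play_zero (S : Seller) (B : Buyer) {f : Round → ℝ≥0∞} (hf : Measurable f) :
    ∫⁻ ω, f (ω 0) ∂(play S B) = ∫⁻ v, ∫⁻ p, f (v, p) ∂S.first ∂B.first := by
  rw [← lintegral_map (f := f) (g := fun ω : ℕ → Round => ω 0) hf (by fun_prop),
    map_eval_zero_play, lintegral_prod _ hf.aemeasurable]

lemma lintegral_play_succ (S : Seller) (B : Buyer) (n : ℕ) {f : History n × Round → ℝ≥0∞}
    (hf : Measurable f) :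
    ∫⁻ ω, f (frestrictLe n ω, ω (n + 1)) ∂(play S B) =
      ∫⁻ ω, ∫⁻ v, ∫⁻ p, f (frestrictLe n ω, (v, p)) ∂(S.next n (observe n (frestrictLe n ω)))
        ∂(B.next n (frestrictLe n ω)) ∂(play S B) := by
  rw [← lintegral_map (f := f) (g := fun ω : ℕ → Round => (frestrictLe n ω, ω (n + 1))) hf
      (by fun_prop), ← map_frestrictLe_play_compProd, Measure.lintegral_compProd hf,
    lintegral_map (hf.lintegral_kernel_prod_right') (by fun_prop)]
  refine lintegral_congr fun ω => ?_
  rw [step, Kernel.prod_apply, Kernel.comap_apply]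
  exact lintegral_prod _ (hf.comp measurable_prodMk_left).aemeasurable

lemma revenueLoss_eq_sum (S : Seller) (B : Buyer) (T : ℕ) :
    revenueLoss S B T =
      (1 / (T : ℝ)) * ∑ t ∈ Finset.range T, ∫ ω, roundLoss (ω t) ∂(play S B) := by
  unfold revenueLoss
  rw [integral_const_mul, integral_finsetSum]
  intro t _
  refine Integrable.of_bound (C := 1)
    (measurable_roundLoss.comp (measurable_pi_apply t)).aestronglyMeasurable
    (Filter.Eventually.of_forall fun ω => ?_)
  rw [Real.norm_of_nonneg (roundLoss_nonneg _)]
  exact roundLoss_le_one _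

/-- The history obtained by appending one more round. -/
def extend {X : Type*} (n : ℕ) (x : ((i : Finset.Iic n) → X) × X) : (i : Finset.Iic (n + 1)) → X :=
  fun i => if h : (i : ℕ) ≤ n then x.1 ⟨i, by simpa using h⟩ else x.2

lemma measurable_extend {X : Type*} [MeasurableSpace X] (n : ℕ) :
    Measurable (extend (X := X) n) := by
  refine measurable_pi_lambda _ fun i => ?_
  by_cases h : (i : ℕ) ≤ n
  · simp only [extend, h, dite_true]; fun_prop
  · simp only [extend, h, dite_false]; fun_prop

lemma ae_notMem_of_lintegral_indicator {Ω α : Type*} [MeasurableSpace Ω] [MeasurableSpace α]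
    {μ : Measure Ω} {A : Set α} (hA : MeasurableSet A) {g : Ω → α} (hg : Measurable g)
    (h : ∫⁻ ω, A.indicator (1 : α → ℝ≥0∞) (g ω) ∂μ = 0) : ∀ᵐ ω ∂μ, g ω ∉ A := by
  have hm : Measurable fun ω => A.indicator (1 : α → ℝ≥0∞) (g ω) :=
    (measurable_one.indicator hA).comp hg
  rw [lintegral_eq_zero_iff hm] at h
  filter_upwards [h] with ω hω hmem
  simp [hmem] at hω

/-! ### Deterministic sellers and amortized analysis. -/

section Automaton

variable {Z : Type*} (z₀ : Z) (upd : Z → Bool → Z) (price : Z → I)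

/-- The states of a deterministic automaton that reads the signals `b 0, b 1, …`. -/
def run (b : ℕ → Bool) : ℕ → Z
  | 0 => z₀
  | n + 1 => upd (run b n) (b n)

variable {z₀ upd} in
lemma run_congr {b b' : ℕ → Bool} {n : ℕ} (h : ∀ i < n, b i = b' i) :
    run z₀ upd b n = run z₀ upd b' n := by
  induction n with
  | zero => rfl
  | succ n ih =>
    rw [run, run, ih fun i hi => h i (by lia), h n (by lia)]

/-- The state of the automaton after the rounds `0, …, n`. -/
def stateAfter (n : ℕ) (b : (i : Finset.Iic n) → Bool) : Z :=
  run z₀ upd (fun i => if h : i ≤ n then b ⟨i, by simpa using h⟩ else false) (n + 1)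

/-- The state of the automaton before round `n` of the play `ω`. -/
def stateAt (ω : ℕ → Round) (n : ℕ) : Z := run z₀ upd (fun i => (signal (ω i)).2) n

lemma stateAfter_frestrictLe (ω : ℕ → Round) (n : ℕ) :
    stateAfter z₀ upd n (fun i => (observe n (frestrictLe n ω) i).2) =
      stateAt z₀ upd ω (n + 1) := by
  refine run_congr fun i hi => ?_
  rw [dif_pos (by lia)]
  rfl

lemma measurable_signals (n : ℕ) :
    Measurable fun (h : SellerHistory n) (i : Finset.Iic n) => (h i).2 := by fun_prop

/-- The seller that posts the prices chosen by a deterministic automaton. -/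
def automatonSeller : Seller where
  first := Measure.dirac (price z₀)
  next n := Kernel.deterministic (fun h => price (stateAfter z₀ upd n fun i => (h i).2))
    ((Measurable.of_discrete (f := fun b => price (stateAfter z₀ upd n b))).comp
      (measurable_signals n))
  first_prob := inferInstance
  next_markov _ := inferInstance

lemma ae_price_eq (B : Buyer) (n : ℕ) :
    ∀ᵐ ω ∂(play (automatonSeller z₀ upd price) B), (ω n).2 = price (stateAt z₀ upd ω n) := by
  cases n with
  | zero =>
    have hm : MeasurableSet {x : Round | x.2 ≠ price z₀} :=
      (measurableSet_eq_fun measurable_snd measurable_const).compl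
    refine ae_notMem_of_lintegral_indicator hm (g := fun ω : ℕ → Round => ω 0)
      (by fun_prop) ?_ |>.mono fun ω hω => not_not.1 hω
    rw [lintegral_play_zero _ _ (measurable_one.indicator hm)]
    refine (lintegral_congr fun v => ?_).trans lintegral_zero
    rw [automatonSeller, lintegral_dirac]
    exact Set.indicator_of_notMem (not_not.2 rfl) _
  | succ n =>
    let st : History n → Z := fun h => stateAfter z₀ upd n fun i => (observe n h i).2
    have hst : Measurable fun h : History n => price (st h) :=
      (Measurable.of_discrete (f := fun b => price (stateAfter z₀ upd n b))).comp
      ((measurable_signals n).comp (measurable_observe n))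
    have hm : MeasurableSet {x : History n × Round | x.2.2 ≠ price (st x.1)} :=
      (measurableSet_eq_fun measurable_snd.snd (hst.comp measurable_fst)).compl
    refine ae_notMem_of_lintegral_indicator hm
      (g := fun ω : ℕ → Round => (frestrictLe n ω, ω (n + 1))) (by fun_prop) ?_ |>.mono
      fun ω hω => (not_not.1 hω).trans (congrArg price (stateAfter_frestrictLe z₀ upd ω n))
    rw [lintegral_play_succ _ _ _ (measurable_one.indicator hm)]
    refine (lintegral_congr fun ω => ?_).trans lintegral_zero
    refine (lintegral_congr fun v => ?_).trans lintegral_zero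
    rw [automatonSeller, Kernel.deterministic_apply, lintegral_dirac]
    exact Set.indicator_of_notMem (not_not.2 rfl) _

/-- The next state is determined by the past, so only the value has to be averaged. The state is a
function of finitely many bits, so no σ-algebra on `Z` is needed. -/
lemma lintegral_next_value (B : Buyer) (n : ℕ) {Ψ : Z → I → ℝ≥0∞} (hΨ : ∀ z, Measurable (Ψ z)) :
    ∫⁻ ω, Ψ (stateAt z₀ upd ω (n + 1)) (ω (n + 1)).1 ∂(play (automatonSeller z₀ upd price) B) =
      ∫⁻ ω, ∫⁻ v, Ψ (stateAt z₀ upd ω (n + 1)) v ∂(B.next n (frestrictLe n ω))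
        ∂(play (automatonSeller z₀ upd price) B) := by
  let bits : History n → (Finset.Iic n → Bool) := fun h i => (observe n h i).2
  have hf : Measurable fun x : History n × Round =>
      Ψ (stateAfter z₀ upd n (bits x.1)) x.2.1 := by
    have h1 : Measurable fun x : (Finset.Iic n → Bool) × I =>
        Ψ (stateAfter z₀ upd n x.1) x.2 :=
      measurable_from_prod_countable_right fun b => hΨ (stateAfter z₀ upd n b)
    exact h1.comp ((((measurable_signals n).comp (measurable_observe n)).comp
      measurable_fst).prodMk measurable_snd.fst)
  have := lintegral_play_succ (automatonSeller z₀ upd price) B n hf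
  simpa [bits, stateAfter_frestrictLe] using this

variable {z₀ upd price} in
/-- An amortized analysis against a stochastic buyer: if `Ψ` is a potential of the state of the
automaton and of the current value such that the loss of a round plus the expected increase of
the potential is at most `R`, then the expected loss of `T` rounds is at most the initial
potential plus `T * R`. -/
theorem sum_lintegral_roundLoss_le {B : Buyer} {ε : ℝ} (hB : B.IsStochastic ε)
    {Ψ : Z → I → ℝ≥0∞} (hΨ : ∀ z, Measurable (Ψ z)) {C₀ R : ℝ≥0∞} (h₀ : ∀ v, Ψ z₀ v ≤ C₀)
    (hstep : ∀ (z : Z) (v : I) (μ : Measure I) [IsProbabilityMeasure μ],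
      (∀ᵐ w : I ∂μ, (w : ℝ) - v ∈ Set.Icc (-ε) ε) → ∫ w : I, ((w : ℝ) - v) ∂μ = 0 →
      ENNReal.ofReal (roundLoss (v, price z)) +
        ∫⁻ w, Ψ (upd z (decide (price z ≤ v))) w ∂μ ≤ Ψ z v + R) (T : ℕ) :
    ∑ t ∈ Finset.range T, ∫⁻ ω, ENNReal.ofReal (roundLoss (ω t))
      ∂(play (automatonSeller z₀ upd price) B) ≤ C₀ + T * R := by
  set P := play (automatonSeller z₀ upd price) B with hP
  suffices h : ∑ t ∈ Finset.range T, ∫⁻ ω, ENNReal.ofReal (roundLoss (ω t)) ∂P +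
      ∫⁻ ω, Ψ (stateAt z₀ upd ω T) (ω T).1 ∂P ≤ C₀ + T * R from le_self_add.trans h
  induction T with
  | zero =>
    simp only [Finset.range_zero, Finset.sum_empty, zero_add, Nat.cast_zero, zero_mul, add_zero]
    refine (lintegral_mono fun ω => h₀ _).trans ?_
    simp
  | succ n ih =>
    have hm : Measurable fun ω : ℕ → Round => ENNReal.ofReal (roundLoss (ω n)) :=
      (measurable_roundLoss.comp (measurable_pi_apply n)).ennreal_ofReal
    rw [Finset.sum_range_succ, lintegral_next_value z₀ upd price B n hΨ, add_assoc,
      ← lintegral_add_left hm]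
    have h : ∀ᵐ ω ∂P, ENNReal.ofReal (roundLoss (ω n)) +
        ∫⁻ v, Ψ (stateAt z₀ upd ω (n + 1)) v ∂(B.next n (frestrictLe n ω)) ≤
        Ψ (stateAt z₀ upd ω n) (ω n).1 + R := by
      filter_upwards [ae_price_eq z₀ upd price B n] with ω hω
      have := hstep (stateAt z₀ upd ω n) (ω n).1 (B.next n (frestrictLe n ω))
        (hB n (frestrictLe n ω)).1 (hB n (frestrictLe n ω)).2
      rw [← hω] at this
      exact this
    calc _ ≤ _ := add_le_add_right (lintegral_mono_ae h) _
      _ = (∑ t ∈ Finset.range n, ∫⁻ ω, ENNReal.ofReal (roundLoss (ω t)) ∂P +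
          ∫⁻ ω, Ψ (stateAt z₀ upd ω n) (ω n).1 ∂P) + R := by
        rw [lintegral_add_right _ measurable_const, lintegral_const, measure_univ, mul_one,
          add_assoc]
      _ ≤ (C₀ + n * R) + R := by gcongr
      _ = C₀ + (n + 1 : ℕ) * R := by push_cast; ring

variable {z₀ upd price} in
lemma revenueLoss_automatonSeller_le {B : Buyer} {ε : ℝ} (hB : B.IsStochastic ε)
    {Ψ : Z → I → ℝ≥0∞} (hΨ : ∀ z, Measurable (Ψ z)) {C₀ R : ℝ} (hC₀ : 0 ≤ C₀) (hR : 0 ≤ R)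
    (h₀ : ∀ v, Ψ z₀ v ≤ ENNReal.ofReal C₀)
    (hstep : ∀ (z : Z) (v : I) (μ : Measure I) [IsProbabilityMeasure μ],
      (∀ᵐ w : I ∂μ, (w : ℝ) - v ∈ Set.Icc (-ε) ε) → ∫ w : I, ((w : ℝ) - v) ∂μ = 0 →
      ENNReal.ofReal (roundLoss (v, price z)) +
        ∫⁻ w, Ψ (upd z (decide (price z ≤ v))) w ∂μ ≤ Ψ z v + ENNReal.ofReal R)
    {T : ℕ} (hT : 1 ≤ T) :
    revenueLoss (automatonSeller z₀ upd price) B T ≤ C₀ / T + R := by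
  have hT' : (0 : ℝ) < T := by exact_mod_cast hT
  have h := sum_lintegral_roundLoss_le hB hΨ h₀ hstep T
  have hint : ∀ t, ∫ ω, roundLoss (ω t) ∂(play (automatonSeller z₀ upd price) B) =
      (∫⁻ ω, ENNReal.ofReal (roundLoss (ω t))
        ∂(play (automatonSeller z₀ upd price) B)).toReal := fun t =>
    integral_eq_lintegral_of_nonneg_ae (Filter.Eventually.of_forall fun ω => roundLoss_nonneg _)
      (measurable_roundLoss.comp (measurable_pi_apply t)).aestronglyMeasurable
  have hfin : ∀ t, ∫⁻ ω, ENNReal.ofReal (roundLoss (ω t))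
        ∂(play (automatonSeller z₀ upd price) B) ≠ ∞ := fun t =>
    ((lintegral_mono fun ω => ENNReal.ofReal_le_one.2 (roundLoss_le_one _)).trans_lt
      (by simp)).ne
  rw [revenueLoss_eq_sum, Finset.sum_congr rfl fun t _ => hint t,
    ← ENNReal.toReal_sum fun t _ => hfin t]
  have h2 : (∑ t ∈ Finset.range T, ∫⁻ ω, ENNReal.ofReal (roundLoss (ω t))
      ∂(play (automatonSeller z₀ upd price) B)).toReal ≤ C₀ + T * R := by
    refine ENNReal.toReal_le_of_le_ofReal (by positivity) (h.trans (le_of_eq ?_))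
    rw [ENNReal.ofReal_add hC₀ (by positivity), ENNReal.ofReal_mul (by positivity),
      ENNReal.ofReal_natCast]
  rw [one_div, inv_mul_le_iff₀ hT']
  refine h2.trans (le_of_eq ?_)
  field_simp

end Automaton

/-- If `F` is bounded by a nonnegative affine function of a mean-zero increment, then its mean is
at most the value of that function at `0`. -/
lemma lintegral_le_of_le_affine {μ : Measure I} [IsProbabilityMeasure μ] {v : I}
    (hmean : ∫ w : I, ((w : ℝ) - v) ∂μ = 0) {F : I → ℝ≥0∞} {a b : ℝ}
    (hF : ∀ᵐ w : I ∂μ, 0 ≤ a + b * ((w : ℝ) - v) ∧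
      F w ≤ ENNReal.ofReal (a + b * ((w : ℝ) - v))) :
    ∫⁻ w, F w ∂μ ≤ ENNReal.ofReal a := by
  have hi : Integrable (fun w : I => (w : ℝ) - v) μ := by
    refine Integrable.of_bound (C := 1) (by fun_prop) (Filter.Eventually.of_forall fun w => ?_)
    rw [Real.norm_eq_abs, abs_le]
    constructor <;> linarith [w.2.1, w.2.2, v.2.1, v.2.2]
  calc ∫⁻ w, F w ∂μ ≤ ∫⁻ w : I, ENNReal.ofReal (a + b * ((w : ℝ) - v)) ∂μ :=
        lintegral_mono_ae (hF.mono fun w h => h.2)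
    _ = ENNReal.ofReal (∫ w : I, (a + b * ((w : ℝ) - v)) ∂μ) :=
        (ofReal_integral_eq_lintegral_ofReal
          ((integrable_const a).add (hi.const_mul b)) (hF.mono fun w h => h.1)).symm
    _ = ENNReal.ofReal a := by
        rw [integral_add (integrable_const a) (hi.const_mul b), integral_const_mul, hmean]
        simp

/-! ### The phase algorithm and its potential. -/

/-- The state of the adaptive pricing algorithm. A phase starts with the belief that the value lies
about `width` to `3 * width` above `base`. It posts `base` for about `1 / width` rounds,
then scans the prices `base + i * width` upwards, for `i = 1, …, 4`. -/
structure PhaseState where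
  base : ℝ
  width : ℝ
  round : ℕ

namespace PhaseState

/-- The number of rounds before the scan begins (up to one). -/
def length (z : PhaseState) : ℕ := ⌊1 / z.width⌋₊

/-- The position in the scan. -/
def level (z : PhaseState) : ℕ := z.round - z.length

/-- The price that the algorithm wants to post, possibly outside of `[0,1]`. -/
def target (z : PhaseState) : ℝ := z.base + z.level * z.width

/-- The posted price. -/
def price (z : PhaseState) : I := Set.projIcc 0 1 zero_le_one z.target

/-- The successor state, depending on whether the value was at least the target price. A phase that
ends during the scan halves the width; one that ends too early or too late doubles it. -/
def next (z : PhaseState) (sold : Prop) [Decidable sold] : PhaseState :=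
  if sold then
    if z.round < z.length + 4 then ⟨z.base, z.width, z.round + 1⟩ else ⟨z.base, 2 * z.width, 0⟩
  else if z.level = 0 then ⟨z.base - 4 * z.width, 2 * z.width, 0⟩
  else ⟨z.base + (z.level - 1) * z.width - z.width / 2, z.width / 2, 0⟩

/-- The transition of the algorithm. A target price above `1` counts as not sold. -/
def update (z : PhaseState) (b : Bool) : PhaseState := z.next (z.target ≤ 1 ∧ b)

/-- The initial state. -/
def init : PhaseState := ⟨0, 1, 0⟩

/-- Clipping the price to `[0,1]` loses no information: a target below `0` is always met, and one
above `1` never is. -/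
lemma target_le_one_and_price_le_iff (z : PhaseState) (v : I) :
    (z.target ≤ 1 ∧ decide (z.price ≤ v) = true) ↔ z.target ≤ v := by
  have hv := v.2
  rw [decide_eq_true_iff, ← Subtype.coe_le_coe, price, Set.coe_projIcc]
  constructor
  · rintro ⟨h1, h2⟩
    exact ((le_min h1 le_rfl).trans (le_max_right _ _)).trans h2
  · intro h
    exact ⟨h.trans hv.2, max_le hv.1 ((min_le_right _ _).trans h)⟩

lemma update_eq (z : PhaseState) (v : I) :
    z.update (decide (z.price ≤ v)) = z.next (z.target ≤ v) := by
  unfold update next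
  simp only [target_le_one_and_price_le_iff]

lemma roundLoss_le_sub_target {z : PhaseState} {v : I} (h : z.target ≤ v) :
    roundLoss (v, z.price) ≤ v - z.target := by
  have h' := (z.target_le_one_and_price_le_iff v).2 h
  have hp : z.price ≤ v := by simpa using h'.2
  have : z.target ≤ (z.price : ℝ) := by
    rw [price, Set.coe_projIcc]
    exact (le_min h'.1 le_rfl).trans (le_max_right _ _)
  simp only [roundLoss, hp, if_true]
  linarith

/-- The amortized cost of a state if the current value is `v`. -/
def potential (ε g : ℝ) (z : PhaseState) (v : ℝ) : ℝ :=
  16 * ((v - z.base - 2 * z.width) ^ 2 + z.width ^ 2) / g ^ 2 + 14 * (g / z.width) +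
    (2 / z.width - min z.round z.length) * max (v - z.base) (-ε) + 30 * g * z.round +
    (5 - z.level)

/-- What is known about the value in a given state. -/
def Valid (ε : ℝ) (z : PhaseState) (v : ℝ) : Prop :=
  0 < z.width ∧ z.level ≤ 4 ∧ (0 < z.level → (z.level - 1) * z.width - ε ≤ v - z.base)

open Classical in
/-- The potential, infinite where the state contradicts the value. -/
def extPotential (ε g : ℝ) (z : PhaseState) (v : I) : ℝ≥0∞ :=
  if Valid ε z v then ENNReal.ofReal (potential ε g z v) else ∞

lemma measurable_extPotential (ε g : ℝ) (z : PhaseState) : Measurable (extPotential ε g z) := by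
  refine Measurable.ite ?_ ?_ measurable_const
  · unfold Valid
    refine (MeasurableSet.const _).inter ((MeasurableSet.const _).inter ?_)
    by_cases h : 0 < z.level
    · simp only [h, true_imp_iff]
      exact measurableSet_le measurable_const (by fun_prop)
    · simp only [h, false_imp_iff]
      exact MeasurableSet.const _
  · unfold potential
    fun_prop

variable {ε g : ℝ}

lemma length_le {z : PhaseState} (hw : 0 < z.width) : (z.length : ℝ) ≤ 1 / z.width :=
  Nat.floor_le (by positivity)

lemma lt_length (z : PhaseState) : 1 / z.width < z.length + 1 := Nat.lt_floor_add_one _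

lemma slope_nonneg {z : PhaseState} (hw : 0 < z.width) :
    0 ≤ 2 / z.width - (min z.round z.length : ℕ) := by
  have h1 := length_le hw
  have h2 : ((min z.round z.length : ℕ) : ℝ) ≤ z.length := by exact_mod_cast min_le_right _ _
  have h3 : 2 / z.width = 1 / z.width + 1 / z.width := by ring
  have : 0 < 1 / z.width := by positivity
  linarith

/-- Because the potential truncates the excess over the base at `-ε`, a value far below the base
makes the prepaid term negative by `2 g/w` at most, which the other terms absorb. -/
lemma slope_mul_ge {z : PhaseState} (hw : 0 < z.width) (hε : 0 ≤ ε) (hεg : ε ≤ g) {m : ℝ}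
    (hm : -ε ≤ m) : -(2 * (g / z.width)) ≤ (2 / z.width - (min z.round z.length : ℕ)) * m := by
  have h1 := slope_nonneg hw
  have h2 : 2 / z.width - ((min z.round z.length : ℕ) : ℝ) ≤ 2 / z.width := by
    linarith [Nat.cast_nonneg (α := ℝ) (min z.round z.length)]
  have h3 : 2 / z.width * ε ≤ 2 / z.width * g := by gcongr
  have h4 : (2 / z.width - ((min z.round z.length : ℕ) : ℝ)) * ε ≤ 2 / z.width * ε := by gcongr
  have h5 : 2 / z.width * g = 2 * (g / z.width) := by ring
  nlinarith

lemma potential_nonneg {z : PhaseState} {v : ℝ} (hε : 0 ≤ ε) (hεg : ε ≤ g)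
    (h : Valid ε z v) : 0 ≤ potential ε g z v := by
  obtain ⟨hw, hl, -⟩ := h
  have hg : 0 ≤ g := hε.trans hεg
  have h1 := slope_mul_ge hw hε hεg (le_max_right (v - z.base) (-ε))
  have h2 : (z.level : ℝ) ≤ 4 := by exact_mod_cast hl
  have h3 : 0 ≤ g / z.width := by positivity
  have h4 : 0 ≤ 16 * ((v - z.base - 2 * z.width) ^ 2 + z.width ^ 2) / g ^ 2 := by positivity
  have h5 : 0 ≤ 30 * g * z.round := by positivity
  unfold potential
  linarith

/-- A bound for the expected potential after the value `v` has made a mean-zero step, if `M` bounds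
the expectation of `max (v - z.base) (-ε)`. -/
def meanBound (ε g : ℝ) (z : PhaseState) (v M : ℝ) : ℝ :=
  16 * ((v - z.base - 2 * z.width) ^ 2 + z.width ^ 2) / g ^ 2 + 16 * (ε ^ 2 / g ^ 2) +
    14 * (g / z.width) + (2 / z.width - (min z.round z.length : ℕ)) * M + 30 * g * z.round +
    (5 - z.level)

lemma meanBound_nonneg {z : PhaseState} {v M : ℝ} (hε : 0 ≤ ε) (hεg : ε ≤ g)
    (hw : 0 < z.width) (hl : z.level ≤ 4) (hM : -ε ≤ M) : 0 ≤ meanBound ε g z v M := by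
  have hg : 0 ≤ g := hε.trans hεg
  have h1 := slope_mul_ge hw hε hεg hM
  have h2 : (z.level : ℝ) ≤ 4 := by exact_mod_cast hl
  have h3 : 0 ≤ g / z.width := by positivity
  have h4 : 0 ≤ 16 * ((v - z.base - 2 * z.width) ^ 2 + z.width ^ 2) / g ^ 2 := by positivity
  have h5 : 0 ≤ 30 * g * z.round := by positivity
  have h6 : 0 ≤ ε ^ 2 / g ^ 2 := by positivity
  unfold meanBound
  linarith

/-- Apart from `16 x²/g²`, bounded by its maximum, and the truncated term, majorized by hypothesis,
everything is affine in the step `x`; the linear part vanishes on average. -/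
lemma potential_add_le {z : PhaseState} {v x M b : ℝ} (hw : 0 < z.width)
    (hx : x ∈ Set.Icc (-ε) ε) (hM : max (v - z.base + x) (-ε) ≤ M + b * x) :
    potential ε g z (v + x) ≤ meanBound ε g z v M +
      (32 * (v - z.base - 2 * z.width) / g ^ 2 +
        (2 / z.width - (min z.round z.length : ℕ)) * b) * x := by
  have h1 := mul_le_mul_of_nonneg_left hM (slope_nonneg hw)
  have h2 : x ^ 2 / g ^ 2 ≤ ε ^ 2 / g ^ 2 := by
    have : x ^ 2 ≤ ε ^ 2 := sq_le_sq' hx.1 hx.2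
    gcongr
  have h3 : 16 * ((v + x - z.base - 2 * z.width) ^ 2 + z.width ^ 2) / g ^ 2 =
      16 * ((v - z.base - 2 * z.width) ^ 2 + z.width ^ 2) / g ^ 2 +
      32 * (v - z.base - 2 * z.width) / g ^ 2 * x + 16 * (x ^ 2 / g ^ 2) := by ring
  have h4 : v + x - z.base = v - z.base + x := by ring
  unfold potential meanBound
  rw [h3, h4]
  linarith

/-- The expected potential after the value has made a mean-zero step. -/
lemma lintegral_extPotential_le {z : PhaseState} {v : I} {μ : Measure I} [IsProbabilityMeasure μ]
    (hsupp : ∀ᵐ w : I ∂μ, (w : ℝ) - v ∈ Set.Icc (-ε) ε)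
    (hmean : ∫ w : I, ((w : ℝ) - v) ∂μ = 0) (hε : 0 ≤ ε) (hεg : ε ≤ g)
    (hw : 0 < z.width) (hl : z.level ≤ 4)
    (hv : 0 < z.level → (z.level - 1) * z.width ≤ v - z.base) {M b : ℝ}
    (hM : ∀ x ∈ Set.Icc (-ε) ε, max (v - z.base + x) (-ε) ≤ M + b * x) :
    ∫⁻ w, extPotential ε g z w ∂μ ≤ ENNReal.ofReal (meanBound ε g z v M) := by
  refine lintegral_le_of_le_affine hmean
    (b := 32 * (v - z.base - 2 * z.width) / g ^ 2 +
      (2 / z.width - (min z.round z.length : ℕ)) * b) ?_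
  filter_upwards [hsupp] with w hx
  have hvalid : Valid ε z w := by
    refine ⟨hw, hl, fun h => ?_⟩
    have := hv h
    linarith [hx.1]
  have h0 := potential_nonneg hε hεg hvalid
  have hle := potential_add_le (g := g) hw hx (hM _ hx)
  rw [add_sub_cancel] at hle
  refine ⟨h0.trans hle, ?_⟩
  rw [extPotential, if_pos hvalid]
  exact ENNReal.ofReal_le_ofReal hle

/-- The amortized analysis reduces to a pointwise inequality for the successor state. -/
lemma step_le_of_meanBound {z z' : PhaseState} {v : I} {μ : Measure I} [IsProbabilityMeasure μ]
    (hsupp : ∀ᵐ w : I ∂μ, (w : ℝ) - v ∈ Set.Icc (-ε) ε)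
    (hmean : ∫ w : I, ((w : ℝ) - v) ∂μ = 0) (hε : 0 ≤ ε) (hεg : ε ≤ g)
    (hz : Valid ε z v) (hw : 0 < z'.width) (hl : z'.level ≤ 4)
    (hv : 0 < z'.level → (z'.level - 1) * z'.width ≤ v - z'.base) {M b : ℝ}
    (hM : ∀ x ∈ Set.Icc (-ε) ε, max (v - z'.base + x) (-ε) ≤ M + b * x)
    (h : roundLoss (v, z.price) + meanBound ε g z' v M ≤ potential ε g z v + 48 * g) :
    ENNReal.ofReal (roundLoss (v, z.price)) + ∫⁻ w, extPotential ε g z' w ∂μ ≤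
      extPotential ε g z v + ENNReal.ofReal (48 * g) := by
  have hM0 : -ε ≤ M := by
    have := hM 0 ⟨by linarith, hε⟩
    rw [mul_zero, add_zero, add_zero] at this
    exact (le_max_right _ _).trans this
  refine (add_le_add_right
    (lintegral_extPotential_le hsupp hmean hε hεg hw hl hv hM) _).trans ?_
  rw [extPotential, if_pos hz, ← ENNReal.ofReal_add (roundLoss_nonneg _)
    (meanBound_nonneg hε hεg hw hl hM0), ← ENNReal.ofReal_add (potential_nonneg hε hεg hz)
    (by linarith)]
  exact ENNReal.ofReal_le_ofReal h

/-- The variance of one step, in units of `g`, fits into the budget of one round. This is the source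
of the exponent `2/3`. -/
lemma sq_div_sq_le (hg : 0 < g) (hεg3 : ε ^ 2 ≤ g ^ 3) : ε ^ 2 / g ^ 2 ≤ g := by
  rw [div_le_iff₀ (by positivity)]
  linarith [hεg3, show g * g ^ 2 = g ^ 3 by ring]

/-- The amortized payments suffice for a constant. -/
lemma three_le_sq_add {w : ℝ} (hg : 0 < g) (hw : 0 < w) :
    3 ≤ w ^ 2 / g ^ 2 + 2 * (g / w) := by
  have h : w ^ 2 / g ^ 2 + 2 * (g / w) - 3 = (w - g) ^ 2 * (w + 2 * g) / (g ^ 2 * w) := by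
    field_simp
    ring
  have : 0 ≤ (w - g) ^ 2 * (w + 2 * g) / (g ^ 2 * w) := by positivity
  linarith

/-! ### The four transitions of the algorithm. -/

/-- Before the scan, the factor of the prepaid term falls by one, which pays exactly the loss `v -
base`. From then on that factor is constant and the unit by which `5 - level` falls pays. The budget
covers `30 g` for the round counter and `16 g` for the variance. -/
lemma roundLoss_add_meanBound_sold {z : PhaseState} {v : I} (hg : 0 < g)
    (hεg3 : ε ^ 2 ≤ g ^ 3) (hz : Valid ε z v) (hs : z.target ≤ v) :
    roundLoss (v, z.price) +
      meanBound ε g ⟨z.base, z.width, z.round + 1⟩ v (v - z.base) ≤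
        potential ε g z v + 48 * g := by
  obtain ⟨hw, -, -⟩ := hz
  have hloss := roundLoss_le_sub_target hs
  have hloss1 := roundLoss_le_one (v, z.price)
  have he := sq_div_sq_le hg hεg3
  have hlw : 0 ≤ (z.level : ℝ) * z.width := by positivity
  have hd : 0 ≤ (v : ℝ) - z.base := by unfold target at hs; linarith
  have hmax : (2 / z.width - (min z.round z.length : ℕ)) * (v - z.base) ≤
      (2 / z.width - (min z.round z.length : ℕ)) * max (v - z.base) (-ε) :=
    mul_le_mul_of_nonneg_left (le_max_left _ _) (slope_nonneg hw)
  have hlen : (⟨z.base, z.width, z.round + 1⟩ : PhaseState).length = z.length := rfl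
  unfold target at hloss hs
  unfold meanBound potential
  rw [level, hlen]
  simp only
  rcases lt_or_ge z.round z.length with h | h
  · have e1 : min (z.round + 1) z.length = z.round + 1 := by lia
    have e2 : min z.round z.length = z.round := by lia
    have e3 : z.round + 1 - z.length = 0 := by lia
    have e4 : z.level = 0 := by unfold level; lia
    rw [e2] at hmax ⊢
    rw [e1, e3, e4]
    rw [e4] at hloss
    push_cast at *
    linarith
  · have e1 : min (z.round + 1) z.length = z.length := by lia
    have e2 : min z.round z.length = z.length := by lia
    have e3 : z.round + 1 - z.length = z.level + 1 := by unfold level; lia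
    rw [e2] at hmax ⊢
    rw [e1, e3]
    push_cast at *
    linarith

/-- The value is at least `4w` above the base, so moving the centre up by `2w` and doubling the
width still lowers the quadratic term by `16 w²/g²`. The factor `1/w` of the new prepaid term is at
most what is left of the old one, as `length ≤ 1/w`. -/
lemma roundLoss_add_meanBound_late {z : PhaseState} {v : I} (hg : 0 < g)
    (hεg3 : ε ^ 2 ≤ g ^ 3) (hz : Valid ε z v) (hs : z.target ≤ v)
    (hl : ¬ z.round < z.length + 4) :
    roundLoss (v, z.price) + meanBound ε g ⟨z.base, 2 * z.width, 0⟩ v (v - z.base) ≤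
        potential ε g z v + 48 * g := by
  obtain ⟨hw, hl4, -⟩ := hz
  have hloss1 := roundLoss_le_one (v, z.price)
  have he := sq_div_sq_le hg hεg3
  have h3 := three_le_sq_add hg hw
  have e1 : min z.round z.length = z.length := by lia
  have e2 : z.level = 4 := by unfold level at *; lia
  have e3 : (⟨z.base, 2 * z.width, 0⟩ : PhaseState).level = 0 := Nat.zero_sub _
  have hd : 4 * z.width ≤ (v : ℝ) - z.base := by
    unfold target at hs; rw [e2] at hs; push_cast at hs; linarith
  have hmax : (2 / z.width - z.length) * (v - z.base) ≤
      (2 / z.width - z.length) * max (v - z.base) (-ε) := by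
    have := slope_nonneg hw
    rw [e1] at this
    exact mul_le_mul_of_nonneg_left (le_max_left _ _) this
  have hlen : 1 / z.width * (v - z.base) ≤ (2 / z.width - z.length) * (v - z.base) := by
    have := length_le hw
    have h2 : 2 / z.width = 1 / z.width + 1 / z.width := by ring
    exact mul_le_mul_of_nonneg_right (by linarith) (by linarith)
  have hq : 16 * (((v : ℝ) - z.base - 2 * (2 * z.width)) ^ 2 + (2 * z.width) ^ 2) / g ^ 2 ≤
      16 * ((v - z.base - 2 * z.width) ^ 2 + z.width ^ 2) / g ^ 2 -
        16 * (z.width ^ 2 / g ^ 2) := by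
    rw [← mul_div_assoc, ← sub_div]
    gcongr
    nlinarith
  have hw1 : g / (2 * z.width) = g / z.width / 2 := by field_simp
  have hw2 : 2 / (2 * z.width) = 1 / z.width := by field_simp
  have hgw : 0 < g / z.width := by positivity
  have hu : 0 ≤ z.width ^ 2 / g ^ 2 := by positivity
  have hr : 0 ≤ 30 * g * z.round := by positivity
  unfold meanBound potential
  rw [e3, e1, e2]
  simp only [Nat.zero_min, hw1, hw2]
  push_cast
  linarith

/-- The new centre is the old base, which is closer to a value below the base; this outweighs the
doubled width by `16 w²/g²`. -/
lemma roundLoss_add_meanBound_early {z : PhaseState} {v : I} (hg : 0 < g) (hε : 0 ≤ ε)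
    (hεg : ε ≤ g) (hεg3 : ε ^ 2 ≤ g ^ 3) (hz : Valid ε z v) (hs : ¬ z.target ≤ v)
    (hl : z.level = 0) :
    roundLoss (v, z.price) +
      meanBound ε g ⟨z.base - 4 * z.width, 2 * z.width, 0⟩ v (4 * z.width + ε) ≤
        potential ε g z v + 48 * g := by
  obtain ⟨hw, -, -⟩ := hz
  have hloss1 := roundLoss_le_one (v, z.price)
  have he := sq_div_sq_le hg hεg3
  have h3 := three_le_sq_add hg hw
  have e3 : (⟨z.base - 4 * z.width, 2 * z.width, 0⟩ : PhaseState).level = 0 := Nat.zero_sub _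
  have hd : (v : ℝ) - z.base < 0 := by
    unfold target at hs; rw [hl] at hs; push_cast at hs; linarith
  have hmax := slope_mul_ge (g := g) hw hε hεg (le_max_right ((v : ℝ) - z.base) (-ε))
  have hq : 16 * (((v : ℝ) - (z.base - 4 * z.width) - 2 * (2 * z.width)) ^ 2 +
      (2 * z.width) ^ 2) / g ^ 2 ≤
      16 * ((v - z.base - 2 * z.width) ^ 2 + z.width ^ 2) / g ^ 2 -
        16 * (z.width ^ 2 / g ^ 2) := by
    rw [← mul_div_assoc, ← sub_div]
    gcongr
    nlinarith
  have hw1 : g / (2 * z.width) = g / z.width / 2 := by field_simp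
  have hw2 : 2 / (2 * z.width) * (4 * z.width + ε) = 4 + ε / z.width := by field_simp
  have hw3 : ε / z.width ≤ g / z.width := by gcongr
  have hgw : 0 < g / z.width := by positivity
  have hu : 0 ≤ z.width ^ 2 / g ^ 2 := by positivity
  have hr : 0 ≤ 30 * g * z.round := by positivity
  unfold meanBound potential
  rw [e3, hl]
  simp only [Nat.zero_min, hw1, Nat.cast_zero, sub_zero, hw2, mul_zero]
  linarith

/-- The scan has located the value in an interval of length `w`, up to `ε`, whose midpoint is the
new centre. Halving costs `14 g/w`; it is paid by the savings `30 * g * round ≥ 30 g/w`, since the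
phase has lasted at least `1/w` rounds. The slack `32 ε²/g²` in the quadratic term plus the variance
`16 ε²/g²` use up the budget `48 g`. -/
lemma roundLoss_add_meanBound_scan {z : PhaseState} {v : I} (hg : 0 < g) (hε : 0 ≤ ε)
    (hεg : ε ≤ g) (hεg3 : ε ^ 2 ≤ g ^ 3) (hz : Valid ε z v) (hs : ¬ z.target ≤ v)
    (hl : z.level ≠ 0) :
    roundLoss (v, z.price) + meanBound ε g
      ⟨z.base + (z.level - 1) * z.width - z.width / 2, z.width / 2, 0⟩ v
        (3 / 2 * z.width + ε) ≤ potential ε g z v + 48 * g := by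
  obtain ⟨hw, hl4, hv⟩ := hz
  have hv := hv (Nat.pos_of_ne_zero hl)
  have hloss1 := roundLoss_le_one (v, z.price)
  have he := sq_div_sq_le hg hεg3
  have h3 := three_le_sq_add hg hw
  have e3 : (⟨z.base + (z.level - 1) * z.width - z.width / 2, z.width / 2, 0⟩ :
    PhaseState).level = 0 := Nat.zero_sub _
  have e4 : (z.level : ℝ) ≤ 4 := by exact_mod_cast hl4
  have hmax := slope_mul_ge (g := g) hw hε hεg (le_max_right ((v : ℝ) - z.base) (-ε))
  unfold target at hs
  -- The lower end is known only up to `ε`: the sale that establishes it was one round earlier.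
  set y : ℝ := v - z.base - (z.level - 1) * z.width with hy
  have hy1 : -ε ≤ y := by linarith
  have hy2 : y < z.width := by linarith
  have hq : 16 * (((v : ℝ) - (z.base + (z.level - 1) * z.width - z.width / 2) -
      2 * (z.width / 2)) ^ 2 + (z.width / 2) ^ 2) / g ^ 2 ≤
      16 * ((v - z.base - 2 * z.width) ^ 2 + z.width ^ 2) / g ^ 2 -
        4 * (z.width ^ 2 / g ^ 2) + 32 * (ε ^ 2 / g ^ 2) := by
    have : (v : ℝ) - (z.base + (z.level - 1) * z.width - z.width / 2) -
      2 * (z.width / 2) = y - z.width / 2 := by rw [hy]; ring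
    rw [this]
    have h5 : (y - z.width / 2) ^ 2 ≤ (z.width / 2 + ε) ^ 2 :=
      sq_le_sq' (by linarith) (by linarith)
    have h6 : 16 * ((y - z.width / 2) ^ 2 + (z.width / 2) ^ 2) ≤
        16 * ((v - z.base - 2 * z.width) ^ 2 + z.width ^ 2) - 4 * z.width ^ 2 + 32 * ε ^ 2 := by
      nlinarith [sq_nonneg ((v : ℝ) - z.base - 2 * z.width), sq_nonneg (z.width / 2 - ε)]
    refine (div_le_div_of_nonneg_right h6 (sq_nonneg g)).trans (le_of_eq ?_)
    ring
  have hw1 : g / (z.width / 2) = 2 * (g / z.width) := by field_simp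
  have hw2 : 2 / (z.width / 2) * (3 / 2 * z.width + ε) = 6 + 4 * (ε / z.width) := by
    field_simp
    ring
  have hw3 : ε / z.width ≤ g / z.width := by gcongr
  have hgw : 0 < g / z.width := by positivity
  have hr : 30 * (g / z.width) ≤ 30 * g * z.round := by
    have h6 : z.length + 1 ≤ z.round := by unfold level at hl; lia
    have h7 : 1 / z.width ≤ z.round := by
      have : (z.length : ℝ) + 1 ≤ z.round := by exact_mod_cast h6
      linarith [lt_length z]
    calc 30 * (g / z.width) = 30 * g * (1 / z.width) := by ring
      _ ≤ _ := by gcongr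
  unfold meanBound potential
  rw [e3]
  simp only [Nat.zero_min, hw1, Nat.cast_zero, sub_zero, hw2, mul_zero]
  linarith

/-- The amortized analysis of one round of the algorithm. -/
lemma amortized_step (hg : 0 < g) (hε : 0 ≤ ε) (hεg : ε ≤ g) (hεg3 : ε ^ 2 ≤ g ^ 3)
    (z : PhaseState) (v : I) (μ : Measure I) [IsProbabilityMeasure μ]
    (hsupp : ∀ᵐ w : I ∂μ, (w : ℝ) - v ∈ Set.Icc (-ε) ε)
    (hmean : ∫ w : I, ((w : ℝ) - v) ∂μ = 0) :
    ENNReal.ofReal (roundLoss (v, z.price)) +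
      ∫⁻ w, extPotential ε g (z.update (decide (z.price ≤ v))) w ∂μ ≤
        extPotential ε g z v + ENNReal.ofReal (48 * g) := by
  by_cases hz : Valid ε z v
  swap
  -- An inconsistent state has infinite potential, so the invariant is carried along by finiteness.
  · rw [extPotential, if_neg hz, top_add]
    exact le_top
  have hw := hz.1
  rw [update_eq, next]
  -- A constant majorant suffices when a new phase starts from an unsold item. After a sale the
  -- truncation is inactive, and the exact affine function in `hmax'` leaves no error.
  have hmax : ∀ d M : ℝ, d ≤ M → 0 ≤ M →
      ∀ x ∈ Set.Icc (-ε) ε, max (d + x) (-ε) ≤ M + ε + 0 * x := by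
    intro d M h1 h2 x hx
    exact max_le (by linarith [hx.2]) (by linarith)
  have hmax' : ∀ d : ℝ, 0 ≤ d → ∀ x ∈ Set.Icc (-ε) ε, max (d + x) (-ε) ≤ d + 1 * x := by
    intro d h1 x hx
    exact max_le (by linarith [hx.2]) (by linarith [hx.1])
  have hzero : ∀ p w : ℝ, (⟨p, w, 0⟩ : PhaseState).level = 0 := fun p w => Nat.zero_sub _
  have hlw : 0 ≤ (z.level : ℝ) * z.width := by positivity
  split_ifs with hs hl hl
  · have hd : 0 ≤ (v : ℝ) - z.base := by unfold target at hs; linarith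
    refine step_le_of_meanBound hsupp hmean hε hεg hz hw ?_ ?_ (hmax' _ hd)
      (roundLoss_add_meanBound_sold hg hεg3 hz hs)
    · change z.round + 1 - z.length ≤ 4
      lia
    · intro h
      have h' : (⟨z.base, z.width, z.round + 1⟩ : PhaseState).level = z.level + 1 := by
        change 0 < z.round + 1 - z.length at h
        change z.round + 1 - z.length = z.round - z.length + 1
        lia
      rw [h']
      unfold target at hs
      push_cast
      linarith
  · have hd : 0 ≤ (v : ℝ) - z.base := by unfold target at hs; linarith
    refine step_le_of_meanBound hsupp hmean hε hεg hz (by simpa using hw) ?_ ?_ (hmax' _ hd)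
      (roundLoss_add_meanBound_late hg hεg3 hz hs hl)
    · simp [hzero]
    · simp [hzero]
  · refine step_le_of_meanBound hsupp hmean hε hεg hz (by simpa using hw) ?_ ?_
      (hmax _ _ ?_ (by positivity)) (roundLoss_add_meanBound_early hg hε hεg hεg3 hz hs hl)
    · simp [hzero]
    · simp [hzero]
    · unfold target at hs
      rw [hl] at hs
      push_cast at hs
      linarith
  · refine step_le_of_meanBound hsupp hmean hε hεg hz (by simpa using hw) ?_ ?_
      (hmax _ _ ?_ (by positivity)) (roundLoss_add_meanBound_scan hg hε hεg hεg3 hz hs hl)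
    · simp [hzero]
    · simp [hzero]
    · unfold target at hs
      simp only
      linarith

/-- The constant is `101 = 80 + 14 + 2 + 5`: quadratic term, width term, prepaid loss and level
term. -/
lemma extPotential_init_le (hg : 0 < g) (hg1 : g ≤ 1) (hε : 0 ≤ ε) (v : I) :
    extPotential ε g init v ≤ ENNReal.ofReal (101 / g ^ 2) := by
  have hl : init.level = 0 := Nat.zero_sub _
  rw [extPotential, if_pos ⟨by simp [init], by simp [hl], by simp [hl]⟩]
  refine ENNReal.ofReal_le_ofReal ?_
  have hv := v.2
  unfold potential
  rw [hl]
  simp only [init]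
  have h1 : max ((v : ℝ) - 0) (-ε) ≤ 1 := max_le (by linarith [hv.2]) (by linarith)
  have h2 : 1 ≤ 1 / g ^ 2 := by
    rw [le_div_iff₀ (by positivity)]
    nlinarith
  have h3 : 16 * (((v : ℝ) - 0 - 2 * 1) ^ 2 + 1 ^ 2) / g ^ 2 ≤ 80 * (1 / g ^ 2) := by
    rw [mul_one_div]
    gcongr
    nlinarith [hv.1, hv.2]
  have h4 : (101 : ℝ) / g ^ 2 = 101 * (1 / g ^ 2) := by ring
  generalize max ((v : ℝ) - 0) (-ε) = m at h1 ⊢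
  norm_num at h2 h3 h4 ⊢
  linarith

end PhaseState

/-! ### The upper bound. -/

/-- The adaptive pricing algorithm. -/
def phaseSeller : Seller := automatonSeller PhaseState.init PhaseState.update PhaseState.price

theorem revenueLoss_phaseSeller_le {B : Buyer} {ε g : ℝ} (hB : B.IsStochastic ε)
    (hg : 0 < g) (hg1 : g ≤ 1) (hε : 0 ≤ ε) (hεg : ε ≤ g) (hεg3 : ε ^ 2 ≤ g ^ 3) {T : ℕ}
    (hT : 1 ≤ T) : revenueLoss phaseSeller B T ≤ 101 / g ^ 2 / T + 48 * g :=
  revenueLoss_automatonSeller_le hB (PhaseState.measurable_extPotential ε g) (by positivity)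
    (by positivity) (PhaseState.extPotential_init_le hg hg1 hε)
    (fun z v μ _ => PhaseState.amortized_step hg hε hεg hεg3 z v μ) hT

theorem revenueLoss_phaseSeller_le_rpow {B : Buyer} {ε : ℝ} (hB : B.IsStochastic ε)
    (hε : 0 < ε) (hε1 : ε ≤ 1) {T : ℕ} (hT : 1 ≤ T) :
    revenueLoss phaseSeller B T ≤
      149 * ε ^ (2 / 3 : ℝ) + 149 * (T : ℝ) ^ (-(1 / 3) : ℝ) := by
  have hT0 : (0 : ℝ) < T := by exact_mod_cast hT
  set a := ε ^ (2 / 3 : ℝ) with ha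
  set b := (T : ℝ) ^ (-(1 / 3) : ℝ) with hb
  have ha0 : 0 < a := Real.rpow_pos_of_pos hε _
  have hb0 : 0 < b := Real.rpow_pos_of_pos hT0 _
  have ha1 : a ≤ 1 := Real.rpow_le_one hε.le hε1 (by norm_num)
  have hb1 : b ≤ 1 := Real.rpow_le_one_of_one_le_of_nonpos (by exact_mod_cast hT) (by norm_num)
  have hea : ε ≤ a := by
    calc ε = ε ^ (1 : ℝ) := (Real.rpow_one _).symm
      _ ≤ a := Real.rpow_le_rpow_of_exponent_ge hε hε1 (by norm_num)
  have ha3 : a ^ 3 = ε ^ 2 := by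
    rw [ha, ← Real.rpow_natCast, ← Real.rpow_mul hε.le]
    norm_num
  have hb3 : b ^ 3 * T = 1 := by
    rw [hb, ← Real.rpow_natCast, ← Real.rpow_mul hT0.le]
    norm_num
    rw [Real.rpow_neg_one]
    field_simp
  -- The first entry ensures `ε² ≤ g³`, the second `1 / (g² T) ≤ b`.
  set g := max a b with hg
  have hag : a ≤ g := le_max_left _ _
  have hbg : b ≤ g := le_max_right _ _
  have hg0 : 0 < g := ha0.trans_le hag
  have h := revenueLoss_phaseSeller_le hB hg0 (max_le ha1 hb1) hε.le (hea.trans hag)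
    (ha3.symm.le.trans (by gcongr)) hT
  have h1 : 101 / g ^ 2 / T ≤ 101 * b := by
    rw [div_div, div_le_iff₀ (by positivity)]
    have : b ^ 2 * T * b ≤ g ^ 2 * T * b := by gcongr
    nlinarith [show b ^ 2 * T * b = 1 by rw [← hb3]; ring]
  have h2 : g ≤ a + b := max_le (by linarith) (by linarith)
  linarith

/-! ### Fixed value paths and what a seller can distinguish. -/

/-- What the seller sees if the values are `v 0, v 1, …` and the prices are `q`. -/
def sigs (v : ℕ → I) (n : ℕ) (q : (i : Finset.Iic n) → I) : SellerHistory n :=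
  fun i => signal (v i, q i)

lemma measurable_sigs (v : ℕ → I) (n : ℕ) : Measurable (sigs v n) :=
  measurable_pi_lambda _ fun i =>
    measurable_signal.comp (measurable_const.prodMk (measurable_pi_apply i))

/-- The law of the prices of the rounds `0, …, n` if the values are `v 0, v 1, …`. -/
def pathLaw (S : Seller) (v : ℕ → I) : (n : ℕ) → Measure ((i : Finset.Iic n) → I)
  | 0 => S.first.map fun p _ => p
  | n + 1 => ((pathLaw S v n) ⊗ₘ (S.next n).comap (sigs v n) (measurable_sigs v n)).map (extend n)

instance (S : Seller) (v : ℕ → I) (n : ℕ) : IsProbabilityMeasure (pathLaw S v n) := by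
  induction n with
  | zero => exact Measure.isProbabilityMeasure_map (by fun_prop)
  | succ n ih => exact Measure.isProbabilityMeasure_map (measurable_extend n).aemeasurable

lemma lintegral_pathLaw_succ (S : Seller) (v : ℕ → I) (n : ℕ)
    {f : ((i : Finset.Iic (n + 1)) → I) → ℝ≥0∞} (hf : Measurable f) :
    ∫⁻ q, f q ∂(pathLaw S v (n + 1)) =
      ∫⁻ q, ∫⁻ p, f (extend n (q, p)) ∂(S.next n (sigs v n q)) ∂(pathLaw S v n) := by
  have hm : Measurable fun x => f (extend n x) := hf.comp (measurable_extend n)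
  rw [pathLaw, lintegral_map hf (measurable_extend n), Measure.lintegral_compProd hm]
  simp only [Kernel.comap_apply]

lemma pathLaw_congr (S : Seller) {v v' : ℕ → I} {n : ℕ} (h : ∀ i < n, v i = v' i) :
    pathLaw S v n = pathLaw S v' n := by
  induction n with
  | zero => rfl
  | succ n ih =>
    have hs : sigs v n = sigs v' n := by
      funext q i
      have := Finset.mem_Iic.1 i.2
      rw [sigs, sigs, h i (by lia)]
    simp only [pathLaw, hs, ih fun i hi => h i (by lia)]

lemma measurable_coord {n : ℕ} (i : Finset.Iic n) :
    Measurable fun q : Finset.Iic n → I => q i := measurable_pi_apply i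

lemma measurableSet_coord_le {n : ℕ} (i : Finset.Iic n) (a : I) :
    MeasurableSet {q : Finset.Iic n → I | q i ≤ a} :=
  measurableSet_le (measurable_coord i) measurable_const

/-- Forget the last round. -/
def dropLast {X : Type*} (n : ℕ) (q : Finset.Iic (n + 1) → X) : Finset.Iic n → X :=
  fun i => q ⟨i, Finset.mem_Iic.2 ((Finset.mem_Iic.1 i.2).trans (Nat.le_succ n))⟩

lemma measurable_dropLast {X : Type*} [MeasurableSpace X] (n : ℕ) :
    Measurable (dropLast (X := X) n) :=
  measurable_pi_lambda _ fun _ => measurable_pi_apply (X := fun _ => X) _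

lemma dropLast_comp_extend {X : Type*} (n : ℕ) :
    dropLast (X := X) n ∘ extend n = Prod.fst := by
  funext x i
  have := Finset.mem_Iic.1 i.2
  simp [dropLast, extend, this]

lemma map_dropLast_pathLaw_succ (S : Seller) (v : ℕ → I) (n : ℕ) :
    (pathLaw S v (n + 1)).map (dropLast n) = pathLaw S v n := by
  rw [pathLaw, Measure.map_map (measurable_dropLast n) (measurable_extend n),
    dropLast_comp_extend]
  exact Measure.fst_compProd _ _

/-- The price histories that do not tell the value paths `v` and `v'` apart: whenever they differ,
the item is sold under both of them. -/
def soldSet (v v' : ℕ → I) (n : ℕ) : Set ((i : Finset.Iic n) → I) :=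
  {q | ∀ i : Finset.Iic n, v i = v' i ∨ (q i ≤ v i ∧ q i ≤ v' i)}

lemma measurableSet_soldSet (v v' : ℕ → I) (n : ℕ) : MeasurableSet (soldSet v v' n) := by
  have : soldSet v v' n =
      ⋂ i : Finset.Iic n, {q | v i = v' i ∨ (q i ≤ v i ∧ q i ≤ v' i)} := by
    ext q; simp [soldSet]
  rw [this]
  exact MeasurableSet.iInter fun i => (MeasurableSet.const _).union
    ((measurableSet_coord_le i _).inter (measurableSet_coord_le i _))

lemma sigs_eq_of_mem_soldSet {v v' : ℕ → I} {n : ℕ} {q : (i : Finset.Iic n) → I}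
    (h : q ∈ soldSet v v' n) : sigs v n q = sigs v' n q := by
  funext i
  rcases h i with h | ⟨h1, h2⟩
  · rw [sigs, sigs, h]
  · simp [sigs, signal, h1, h2]

lemma pathLaw_succ_apply_inter (S : Seller) (v : ℕ → I) (n : ℕ)
    {A : Set ((i : Finset.Iic (n + 1)) → I)} (hA : MeasurableSet A)
    {G : Set ((i : Finset.Iic n) → I)} (hG : MeasurableSet G) :
    pathLaw S v (n + 1) (A ∩ dropLast n ⁻¹' G) =
      ∫⁻ q in G, S.next n (sigs v n q) ((fun p => extend n (q, p)) ⁻¹' A) ∂(pathLaw S v n) := by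
  have hpre : extend n ⁻¹' (A ∩ dropLast n ⁻¹' G) =
      extend n ⁻¹' A ∩ Prod.fst ⁻¹' G := by
    rw [Set.preimage_inter, ← Set.preimage_comp, dropLast_comp_extend]
  rw [pathLaw, Measure.map_apply (measurable_extend n)
    (hA.inter (measurable_dropLast n hG)), hpre,
    Measure.compProd_apply ((measurable_extend n hA).inter (measurable_fst hG)),
    ← lintegral_indicator hG]
  refine lintegral_congr fun q => ?_
  by_cases hq : q ∈ G
  · rw [Set.indicator_of_mem hq, Kernel.comap_apply]
    congr 1
    ext p
    simp [hq]
  · rw [Set.indicator_of_notMem hq]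
    have : Prod.mk q ⁻¹' (extend n ⁻¹' A ∩ Prod.fst ⁻¹' G) = (∅ : Set I) := by
      ext p
      simp [hq]
    rw [this, measure_empty]

/-- The next price depends on the signals so far, and these agree on the event. The new price itself
is unrestricted, so the laws still agree in the first round that separates the paths. -/
lemma restrict_pathLaw_succ (S : Seller) {v v' : ℕ → I} {n : ℕ}
    (h : (pathLaw S v n).restrict (soldSet v v' n) = (pathLaw S v' n).restrict (soldSet v v' n)) :
    (pathLaw S v (n + 1)).restrict
        (dropLast n ⁻¹' soldSet v v' n) =
      (pathLaw S v' (n + 1)).restrict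
        (dropLast n ⁻¹' soldSet v v' n) := by
  ext A hA
  have hG := measurableSet_soldSet v v' n
  rw [Measure.restrict_apply hA, Measure.restrict_apply hA, pathLaw_succ_apply_inter S v n hA hG,
    pathLaw_succ_apply_inter S v' n hA hG, ← h]
  refine setLIntegral_congr_fun hG fun q hq => ?_
  simp only [sigs_eq_of_mem_soldSet hq]

lemma soldSet_succ (v v' : ℕ → I) (n : ℕ) : soldSet v v' (n + 1) =
    {q | v (n + 1) = v' (n + 1) ∨
      (q ⟨n + 1, by simp⟩ ≤ v (n + 1) ∧ q ⟨n + 1, by simp⟩ ≤ v' (n + 1))} ∩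
      dropLast n ⁻¹' soldSet v v' n := by
  ext q
  constructor
  · intro h
    exact ⟨h ⟨n + 1, by simp⟩, fun i => h ⟨i, Finset.mem_Iic.2
      ((Finset.mem_Iic.1 i.2).trans (Nat.le_succ n))⟩⟩
  · rintro ⟨h1, h2⟩ ⟨i, hi⟩
    rcases (Finset.mem_Iic.1 hi).lt_or_eq with h | rfl
    · exact h2 ⟨i, Finset.mem_Iic.2 (by lia)⟩
    · exact h1

lemma measurableSet_sold_last (a b : I) (P : Prop) (n : ℕ) :
    MeasurableSet {q : (i : Finset.Iic n) → I |
      P ∨ (q ⟨n, by simp⟩ ≤ a ∧ q ⟨n, by simp⟩ ≤ b)} :=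
  (MeasurableSet.const _).union
    ((measurableSet_coord_le _ a).inter (measurableSet_coord_le _ b))

/-- A seller cannot tell two value paths apart as long as all items are sold. -/
theorem restrict_pathLaw_eq (S : Seller) (v v' : ℕ → I) (n : ℕ) :
    (pathLaw S v n).restrict (soldSet v v' n) = (pathLaw S v' n).restrict (soldSet v v' n) := by
  induction n with
  -- The first price is drawn before any signal.
  | zero => rfl
  | succ n ih =>
    rw [soldSet_succ, ← Measure.restrict_restrict (measurableSet_sold_last _ _ _ _),
      restrict_pathLaw_succ S ih, Measure.restrict_restrict (measurableSet_sold_last _ _ _ _)]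

/-- The probability that the price of round `n` is too high. -/
def overProb (S : Seller) (v : ℕ → I) (n : ℕ) : ℝ :=
  (pathLaw S v n).real {q | v n < q ⟨n, by simp⟩}

/-- The expected loss of round `n`. -/
def pathLoss (S : Seller) (v : ℕ → I) (n : ℕ) : ℝ :=
  ∫ q, roundLoss (v n, q ⟨n, by simp⟩) ∂(pathLaw S v n)

lemma overProb_nonneg (S : Seller) (v : ℕ → I) (n : ℕ) : 0 ≤ overProb S v n := measureReal_nonneg

lemma measurableSet_over (a : I) (n : ℕ) :
    MeasurableSet {q : (i : Finset.Iic n) → I | a < q ⟨n, by simp⟩} :=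
  measurableSet_lt measurable_const (measurable_coord _)

/-- A union bound over the first round that separates the paths. Up to and including the price of
that round both laws agree, so a price above `v'` may be charged to the law for `v'` although the
left side uses the law for `v`. -/
lemma real_soldSet_compl_le (S : Seller) (v v' : ℕ → I) (n : ℕ) :
    (pathLaw S v n).real (soldSet v v' n)ᶜ ≤
      ∑ j ∈ (Finset.range (n + 1)).filter (fun j => v j ≠ v' j),
        (overProb S v j + overProb S v' j) := by
  induction n with
  | zero =>
    by_cases h : v 0 = v' 0
    · have : (soldSet v v' 0)ᶜ = ∅ := by
        rw [Set.compl_empty_iff, Set.eq_univ_iff_forall]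
        rintro q ⟨i, hi⟩
        obtain rfl : i = 0 := by simpa using hi
        exact Or.inl h
      rw [this, measureReal_empty]
      exact Finset.sum_nonneg fun j _ => add_nonneg (overProb_nonneg _ _ _) (overProb_nonneg _ _ _)
    · have hf : (Finset.range (0 + 1)).filter (fun j => v j ≠ v' j) = {0} := by
        ext j
        simp only [Finset.mem_filter, Finset.mem_range, Finset.mem_singleton]
        constructor
        · lia
        · rintro rfl
          exact ⟨by lia, h⟩
      rw [hf, Finset.sum_singleton]
      have hsub : (soldSet v v' 0)ᶜ ⊆ {q | v 0 < q ⟨0, by simp⟩} ∪ {q | v' 0 < q ⟨0, by simp⟩} := by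
        intro q hq
        by_contra hcon
        simp only [Set.mem_union, Set.mem_ofPred_eq, not_or, not_lt] at hcon
        refine hq ?_
        rintro ⟨i, hi⟩
        obtain rfl : i = 0 := by simpa using hi
        exact Or.inr hcon
      exact (measureReal_mono hsub).trans (measureReal_union_le _ _)
  | succ n ih =>
    set r := dropLast (X := I) n
    have hr : Measurable r := measurable_dropLast n
    have hG := measurableSet_soldSet v v' n
    have h1 : (pathLaw S v (n + 1)).real (r ⁻¹' (soldSet v v' n)ᶜ) =
        (pathLaw S v n).real (soldSet v v' n)ᶜ := by
      rw [← map_measureReal_apply hr hG.compl, map_dropLast_pathLaw_succ]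
    rw [Finset.range_add_one, Finset.filter_insert]
    by_cases h : v (n + 1) = v' (n + 1)
    · rw [if_neg (not_not.2 h)]
      refine le_trans (le_of_eq ?_) ih
      rw [← h1]
      congr 1
      rw [soldSet_succ]
      ext q
      simp [h, r]
    · rw [if_pos h, Finset.sum_insert (by simp)]
      have hsub : (soldSet v v' (n + 1))ᶜ ⊆ ({q | v (n + 1) < q ⟨n + 1, by simp⟩} ∪
          ({q | v' (n + 1) < q ⟨n + 1, by simp⟩} ∩ r ⁻¹' soldSet v v' n)) ∪
          r ⁻¹' (soldSet v v' n)ᶜ := by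
        intro q hq
        by_contra hcon
        simp only [Set.mem_union, Set.mem_inter_iff, Set.mem_ofPred_eq, Set.mem_preimage,
          Set.mem_compl_iff, not_or, not_lt, not_not, not_and] at hcon
        refine hq ?_
        rw [soldSet_succ]
        refine ⟨Or.inr ⟨hcon.1.1, ?_⟩, hcon.2⟩
        by_contra hlt
        exact hcon.1.2 (not_le.1 hlt) hcon.2
      have h2 : (pathLaw S v (n + 1)).real
          ({q | v' (n + 1) < q ⟨n + 1, by simp⟩} ∩ r ⁻¹' soldSet v v' n) ≤
          overProb S v' (n + 1) := by
        have hA := measurableSet_over (v' (n + 1)) (n + 1)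
        rw [← measureReal_restrict_apply hA,
          restrict_pathLaw_succ S (restrict_pathLaw_eq S v v' n), measureReal_restrict_apply hA]
        exact measureReal_mono Set.inter_subset_left
      have h3 := measureReal_mono (μ := pathLaw S v (n + 1)) hsub
      have h4 := measureReal_union_le (μ := pathLaw S v (n + 1))
        ({q | v (n + 1) < q ⟨n + 1, by simp⟩} ∪
          ({q | v' (n + 1) < q ⟨n + 1, by simp⟩} ∩ r ⁻¹' soldSet v v' n))
          (r ⁻¹' (soldSet v v' n)ᶜ)
      have h5 := measureReal_union_le (μ := pathLaw S v (n + 1))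
        {q | v (n + 1) < q ⟨n + 1, by simp⟩}
          ({q | v' (n + 1) < q ⟨n + 1, by simp⟩} ∩ r ⁻¹' soldSet v v' n)
      have h6 : (pathLaw S v (n + 1)).real {q | v (n + 1) < q ⟨n + 1, by simp⟩} =
        overProb S v (n + 1) := rfl
      linarith

lemma integrable_roundLoss_path (S : Seller) (v : ℕ → I) (n : ℕ) :
    Integrable (fun q : (i : Finset.Iic n) → I => roundLoss (v n, q ⟨n, by simp⟩))
      (pathLaw S v n) := by
  have hm : Measurable fun q : (i : Finset.Iic n) → I => roundLoss (v n, q ⟨n, by simp⟩) :=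
    measurable_roundLoss.comp (measurable_const.prodMk (measurable_coord _))
  refine Integrable.of_bound (C := 1) hm.aestronglyMeasurable
    (Filter.Eventually.of_forall fun ω => ?_)
  rw [Real.norm_of_nonneg (roundLoss_nonneg _)]
  exact roundLoss_le_one _

lemma pathLoss_nonneg (S : Seller) (v : ℕ → I) (n : ℕ) : 0 ≤ pathLoss S v n :=
  integral_nonneg fun _ => roundLoss_nonneg _

/-- A price that is too high loses the whole value. -/
lemma mul_overProb_le_pathLoss (S : Seller) (v : ℕ → I) (n : ℕ) :
    (v n : ℝ) * overProb S v n ≤ pathLoss S v n := by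
  have hA := measurableSet_over (v n) n
  rw [overProb, mul_comm, ← smul_eq_mul, ← setIntegral_const (μ := pathLaw S v n)]
  calc _ ≤ ∫ q in {q | v n < q ⟨n, by simp⟩}, roundLoss (v n, q ⟨n, by simp⟩) ∂(pathLaw S v n) := by
        refine setIntegral_mono_on (integrable_const _).integrableOn
          (integrable_roundLoss_path S v n).integrableOn hA fun q hq => ?_
        have : ¬ q ⟨n, by simp⟩ ≤ v n := not_le.2 hq
        simp [roundLoss, this]
    _ ≤ _ := setIntegral_le_integral (integrable_roundLoss_path S v n)
        (Filter.Eventually.of_forall fun q => roundLoss_nonneg _)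

lemma roundLoss_add_roundLoss_ge {a b p : I} (ha : p ≤ a) (hb : p ≤ b) :
    |(a : ℝ) - b| ≤ roundLoss (a, p) + roundLoss (b, p) := by
  have h1 : (p : ℝ) ≤ a := ha
  have h2 : (p : ℝ) ≤ b := hb
  simp only [roundLoss, ha, hb, if_true]
  rw [abs_le]
  constructor <;> linarith

/-- If two value paths differ in round `n` by at least `D`, then a seller that does not distinguish
them by a price that is too high loses about `D` on one of them. -/
theorem le_pathLoss_add_pathLoss (S : Seller) (v v' : ℕ → I) (n : ℕ) {D : ℝ} (hD : 0 ≤ D)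
    (hDv : D ≤ |(v n : ℝ) - v' n|) :
    D ≤ pathLoss S v n + pathLoss S v' n +
      D * ∑ j ∈ (Finset.range (n + 1)).filter (fun j => v j ≠ v' j),
        (overProb S v j + overProb S v' j) := by
  have hG := measurableSet_soldSet v v' n
  set G := soldSet v v' n with hGdef
  have hbad := real_soldSet_compl_le S v v' n
  rw [probReal_compl_eq_one_sub hG] at hbad
  have h1 : D * (pathLaw S v n).real G ≤ pathLoss S v n + pathLoss S v' n := by
    have hi := (integrable_roundLoss_path S v n).integrableOn (s := G)
    have hi' := (integrable_roundLoss_path S v' n).integrableOn (s := G)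
    have e := restrict_pathLaw_eq S v v' n
    unfold IntegrableOn at hi hi'
    rw [← hGdef] at e
    rw [← e] at hi'
    calc D * (pathLaw S v n).real G = ∫ q in G, D ∂(pathLaw S v n) := by
          rw [setIntegral_const, smul_eq_mul, mul_comm]
      _ ≤ ∫ q in G, (roundLoss (v n, q ⟨n, by simp⟩) + roundLoss (v' n, q ⟨n, by simp⟩))
            ∂(pathLaw S v n) := by
          refine setIntegral_mono_on (integrable_const _).integrableOn (hi.add hi') hG
            fun q hq => ?_
          -- If the values of round `n` agree, then `D = 0`; otherwise both items are sold at the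
          -- same price.
          rcases hq ⟨n, by simp⟩ with h | ⟨h2, h3⟩
          · simp only at h
            rw [h, sub_self, abs_zero] at hDv
            linarith [roundLoss_nonneg (v n, q ⟨n, by simp⟩),
              roundLoss_nonneg (v' n, q ⟨n, by simp⟩)]
          · exact hDv.trans (roundLoss_add_roundLoss_ge h2 h3)
      _ = ∫ q in G, roundLoss (v n, q ⟨n, by simp⟩) ∂(pathLaw S v n) +
            ∫ q in G, roundLoss (v' n, q ⟨n, by simp⟩) ∂(pathLaw S v' n) := by
          rw [integral_add hi hi', ← e]
      _ ≤ _ := add_le_add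
          (setIntegral_le_integral (integrable_roundLoss_path S v n)
            (Filter.Eventually.of_forall fun q => roundLoss_nonneg _))
          (setIntegral_le_integral (integrable_roundLoss_path S v' n)
            (Filter.Eventually.of_forall fun q => roundLoss_nonneg _))
  have h2 := mul_le_mul_of_nonneg_left hbad hD
  linarith

/-! ### Random bits and the stopped walk. -/

section Signs

variable {N : ℕ}

/-- The `i`-th of `N` bits. -/
def bit (s : Fin N → Bool) (i : ℕ) : Bool := if h : i < N then s ⟨i, h⟩ else false

/-- Flip the bits with index in `A`. -/
def flip (A : Set ℕ) [DecidablePred (· ∈ A)] (s : Fin N → Bool) : Fin N → Bool :=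
  fun i => if (i : ℕ) ∈ A then !s i else s i

lemma flip_flip (A : Set ℕ) [DecidablePred (· ∈ A)] (s : Fin N → Bool) :
    flip A (flip A s) = s := by
  funext i
  by_cases h : (i : ℕ) ∈ A <;> simp [flip, h]

lemma sum_flip {M : Type*} [AddCommMonoid M] (A : Set ℕ) [DecidablePred (· ∈ A)]
    (f : (Fin N → Bool) → M) : ∑ s, f (flip A s) = ∑ s, f s :=
  Equiv.sum_comp (Function.Involutive.toPerm _ (flip_flip A)) f

lemma bit_flip_of_mem {A : Set ℕ} [DecidablePred (· ∈ A)] (s : Fin N → Bool) {i : ℕ} (hi : i < N)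
    (h : i ∈ A) : bit (flip A s) i = !bit s i := by
  simp [bit, flip, hi, h]

lemma bit_flip_of_notMem {A : Set ℕ} [DecidablePred (· ∈ A)] (s : Fin N → Bool) {i : ℕ}
    (h : i ∉ A) : bit (flip A s) i = bit s i := by
  simp [bit, flip, h]

/-- The sign of a bit. -/
def sgn (b : Bool) : ℝ := if b then 1 else -1

lemma sgn_not (b : Bool) : sgn (!b) = -sgn b := by cases b <;> simp [sgn]

lemma sgn_sq (b : Bool) : sgn b ^ 2 = 1 := by cases b <;> simp [sgn]

end Signs

/-- One step of size `η` of a walk that stays put once it is at distance `1/4` from `1/2`. -/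
def moveBy (η : ℝ) (b : Bool) (x : I) : I :=
  if |(x : ℝ) - 1 / 2| < 1 / 4 then Set.projIcc 0 1 zero_le_one (x + sgn b * η) else x

/-- A moving walk is within `1/4` of `1/2`, so a step of at most `1/4` stays in `[0,1]` and the
projection never acts. -/
lemma coe_moveBy {η : ℝ} (h0 : 0 ≤ η) (h1 : η ≤ 1 / 4) (b : Bool) (x : I) :
    (moveBy η b x : ℝ) = x + (if |(x : ℝ) - 1 / 2| < 1 / 4 then sgn b * η else 0) := by
  unfold moveBy
  split_ifs with h
  · rw [abs_lt] at h
    have hmem : (x : ℝ) + sgn b * η ∈ Set.Icc (0 : ℝ) 1 := by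
      cases b <;> simp only [sgn] <;> norm_num <;> constructor <;> linarith
    rw [Set.projIcc_of_mem zero_le_one hmem]
  · simp

lemma measurable_moveBy (η : ℝ) (b : Bool) : Measurable (moveBy η b) := by
  refine Measurable.ite ?_ ?_ measurable_id
  · exact measurableSet_lt (by fun_prop) measurable_const
  · exact continuous_projIcc.measurable.comp (by fun_prop)

/-- The law of the next position of the walk. -/
def coinKernel (η : ℝ) : Kernel I I where
  toFun x := (2⁻¹ : ℝ≥0∞) • Measure.dirac (moveBy η true x) +
    (2⁻¹ : ℝ≥0∞) • Measure.dirac (moveBy η false x)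
  measurable' := by
    refine Measure.measurable_of_measurable_coe _ fun s hs => ?_
    simp only [Measure.add_apply, Measure.smul_apply, smul_eq_mul, Measure.dirac_apply' _ hs]
    have h (b : Bool) : Measurable fun x => s.indicator (1 : I → ℝ≥0∞) (moveBy η b x) :=
      (measurable_one.indicator hs).comp (measurable_moveBy η b)
    exact ((h true).const_mul _).add ((h false).const_mul _)

lemma coinKernel_apply (η : ℝ) (x : I) :
    coinKernel η x = (2⁻¹ : ℝ≥0∞) • Measure.dirac (moveBy η true x) +
      (2⁻¹ : ℝ≥0∞) • Measure.dirac (moveBy η false x) := rfl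

instance (η : ℝ) : IsMarkovKernel (coinKernel η) where
  isProbabilityMeasure x := ⟨by
    simp [coinKernel_apply, ENNReal.inv_two_add_inv_two]⟩

lemma lintegral_coinKernel (η : ℝ) (x : I) (f : I → ℝ≥0∞) :
    ∫⁻ y, f y ∂(coinKernel η x) = 2⁻¹ * f (moveBy η true x) + 2⁻¹ * f (moveBy η false x) := by
  rw [coinKernel_apply, lintegral_add_measure, lintegral_smul_measure, lintegral_smul_measure,
    lintegral_dirac, lintegral_dirac]
  rfl

/-- The walk driven by the bits `s`, from `1/2`. -/
def walk {N : ℕ} (η : ℝ) (s : Fin N → Bool) : ℕ → I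
  | 0 => ⟨1 / 2, by norm_num, by norm_num⟩
  | n + 1 => moveBy η (bit s n) (walk η s n)

lemma walk_congr {N : ℕ} {η : ℝ} {s s' : Fin N → Bool} {n : ℕ}
    (h : ∀ i < n, bit s i = bit s' i) : walk η s n = walk η s' n := by
  induction n with
  | zero => rfl
  | succ n ih => rw [walk, walk, ih fun i hi => h i (by lia), h n (by lia)]

lemma sum_const_signs (N : ℕ) : ∑ _s : Fin N → Bool, ((2 : ℝ≥0∞) ^ N)⁻¹ = 1 := by
  rw [Finset.sum_const, Finset.card_univ, Fintype.card_fun, Fintype.card_bool, Fintype.card_fin,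
    nsmul_eq_mul]
  push_cast
  exact ENNReal.mul_inv_cancel (by simp) (by simp)

/-- The buyer whose value is the walk, started after `L` of its steps. -/
def walkBuyer (η : ℝ) (L N : ℕ) : Buyer where
  first := ∑ s : Fin N → Bool, ((2 : ℝ≥0∞) ^ N)⁻¹ • Measure.dirac (walk η s L)
  next n := (coinKernel η).comap (fun h => (h ⟨n, by simp⟩).1) (by fun_prop)
  first_prob := ⟨by
    simp only [Measure.finsetSum_apply, Measure.smul_apply, measure_univ, smul_eq_mul, mul_one]
    exact sum_const_signs N⟩
  next_markov _ := inferInstance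

lemma isStochastic_walkBuyer {η ε : ℝ} (h0 : 0 ≤ η) (h1 : η ≤ 1 / 4) (hε : η ≤ ε) (L N : ℕ) :
    (walkBuyer η L N).IsStochastic ε := by
  intro n h
  set x : I := (h ⟨n, by simp⟩).1 with hx
  have hk : (walkBuyer η L N).next n h = coinKernel η x := rfl
  have hb : ∀ b, ((moveBy η b x : I) : ℝ) - x ∈ Set.Icc (-ε) ε := by
    intro b
    rw [coe_moveBy h0 h1, add_sub_cancel_left]
    split_ifs
    · cases b <;> simp only [sgn] <;> norm_num <;> constructor <;> linarith
    · constructor <;> linarith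
  have hm : MeasurableSet {w : I | (w : ℝ) - x ∈ Set.Icc (-ε) ε} := by
    have : Measurable fun w : I => (w : ℝ) - x := by fun_prop
    exact this measurableSet_Icc
  rw [hk, coinKernel_apply]
  constructor
  · rw [ae_add_measure_iff]
    exact ⟨Measure.ae_smul_measure ((ae_dirac_iff hm).2 (hb _)) _,
      Measure.ae_smul_measure ((ae_dirac_iff hm).2 (hb _)) _⟩
  · have hi : ∀ μ : Measure I, IsFiniteMeasure μ → Integrable (fun w : I => (w : ℝ) - x) μ := by
      intro μ _
      refine Integrable.of_bound (C := 1) (by fun_prop) (Filter.Eventually.of_forall fun w => ?_)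
      rw [Real.norm_eq_abs, abs_le]
      constructor <;> linarith [w.2.1, w.2.2, x.2.1, x.2.2]
    rw [integral_add_measure ((hi _ inferInstance).smul_measure (by simp))
      ((hi _ inferInstance).smul_measure (by simp)), integral_smul_measure, integral_smul_measure,
      integral_dirac, integral_dirac, coe_moveBy h0 h1, coe_moveBy h0 h1]
    split_ifs <;> simp [sgn]

/-! ### The play against the walk as a mixture over bits. -/

/-- Combine values and prices to a history. -/
def attach (v : ℕ → I) (n : ℕ) (q : (i : Finset.Iic n) → I) : History n := fun i => (v i, q i)

lemma measurable_attach (v : ℕ → I) (n : ℕ) : Measurable (attach v n) :=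
  measurable_pi_lambda _ fun i => measurable_const.prodMk (measurable_pi_apply i)

lemma attach_extend (v : ℕ → I) (n : ℕ) (x : ((i : Finset.Iic n) → I) × I) :
    attach v (n + 1) (extend n x) = extend n (attach v n x.1, (v (n + 1), x.2)) := by
  funext i
  have hi := Finset.mem_Iic.1 i.2
  by_cases h : (i : ℕ) ≤ n
  · simp [attach, extend, h]
  · have : (i : ℕ) = n + 1 := by lia
    simp [attach, extend, this]

lemma extend_frestrictLe {X : Type*} (n : ℕ) (ω : ℕ → X) :
    extend n (frestrictLe n ω, ω (n + 1)) = frestrictLe (π := fun _ => X) (n + 1) ω := by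
  funext i
  have hi := Finset.mem_Iic.1 i.2
  by_cases h : (i : ℕ) ≤ n
  · simp [extend, h]
  · have : (i : ℕ) = n + 1 := by lia
    simp [extend, this]

/-- The expectation of `f` if the values of the rounds `0, …, n` are those of `v` and the value of
round `n + 1` is `w`. -/
def pathExp (S : Seller) (n : ℕ) (f : History (n + 1) → ℝ≥0∞) (v : ℕ → I) (w : I) : ℝ≥0∞ :=
  ∫⁻ q, ∫⁻ p, f (extend n (attach v n q, (w, p))) ∂(S.next n (sigs v n q)) ∂(pathLaw S v n)

lemma pathExp_congr (S : Seller) {n : ℕ} (f : History (n + 1) → ℝ≥0∞) {v v' : ℕ → I}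
    (h : ∀ i ≤ n, v i = v' i) (w : I) : pathExp S n f v w = pathExp S n f v' w := by
  have h1 : attach v n = attach v' n := by
    funext q i
    rw [attach, attach, h i (Finset.mem_Iic.1 i.2)]
  have h2 : sigs v n = sigs v' n := by
    funext q i
    rw [sigs, sigs, h i (Finset.mem_Iic.1 i.2)]
  rw [pathExp, pathExp, h1, h2, pathLaw_congr S fun i hi => h i hi.le]

lemma pathExp_self (S : Seller) {n : ℕ} {f : History (n + 1) → ℝ≥0∞} (hf : Measurable f)
    (v : ℕ → I) :
    ∫⁻ q, f (attach v (n + 1) q) ∂(pathLaw S v (n + 1)) = pathExp S n f v (v (n + 1)) := by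
  have hm : Measurable fun q => f (attach v (n + 1) q) := hf.comp (measurable_attach v (n + 1))
  rw [lintegral_pathLaw_succ S v n hm]
  simp only [attach_extend]
  rfl

lemma lintegral_coinKernel_pathExp (S : Seller) (η : ℝ) {n : ℕ} {f : History (n + 1) → ℝ≥0∞}
    (hf : Measurable f) (v : ℕ → I) (x : I) :
    ∫⁻ q, ∫⁻ w, ∫⁻ p, f (extend n (attach v n q, (w, p))) ∂(S.next n (sigs v n q))
        ∂(coinKernel η x) ∂(pathLaw S v n) =
      2⁻¹ * pathExp S n f v (moveBy η true x) + 2⁻¹ * pathExp S n f v (moveBy η false x) := by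
  have hm : ∀ w : I, Measurable fun q : (i : Finset.Iic n) → I =>
      ∫⁻ p, f (extend n (attach v n q, (w, p))) ∂(S.next n (sigs v n q)) := by
    intro w
    have h1 : Measurable fun x : ((i : Finset.Iic n) → I) × I =>
        f (extend n (attach v n x.1, (w, x.2))) :=
      hf.comp ((measurable_extend n).comp (((measurable_attach v n).comp measurable_fst).prodMk
        (measurable_const.prodMk measurable_snd)))
    exact h1.lintegral_kernel_prod_right' (κ := (S.next n).comap (sigs v n) (measurable_sigs v n))
  simp only [lintegral_coinKernel]
  rw [lintegral_add_left ((hm _).const_mul _), lintegral_const_mul _ (hm _),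
    lintegral_const_mul _ (hm _)]
  rfl

/-- The values of the rounds `0, 1, …` of `walkBuyer η L N`, as a function of the bits. -/
def walkValue {N : ℕ} (η : ℝ) (L : ℕ) (s : Fin N → Bool) (t : ℕ) : I := walk η s (L + t)

/-- Bit `L + n` does not influence the values of the rounds up to `n`, so pairing each `s` with its
flip at this bit turns the uniform sum into a fresh coin toss. -/
lemma sum_pathExp_walkValue (S : Seller) (η : ℝ) {L N n : ℕ} (hn : L + n < N)
    (f : History (n + 1) → ℝ≥0∞) :
    ∑ s : Fin N → Bool, (2⁻¹ * pathExp S n f (walkValue η L s)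
          (moveBy η true (walkValue η L s n)) +
        2⁻¹ * pathExp S n f (walkValue η L s) (moveBy η false (walkValue η L s n))) =
      ∑ s : Fin N → Bool, pathExp S n f (walkValue η L s) (walkValue η L s (n + 1)) := by
  classical
  have hflip : ∀ s : Fin N → Bool, ∀ i ≤ n,
      walkValue η L (flip {L + n} s) i = walkValue η L s i := by
    intro s i hi
    refine walk_congr fun j hj => bit_flip_of_notMem s ?_
    simp only [Set.mem_singleton_iff]
    lia
  have hJ : ∀ s : Fin N → Bool, pathExp S n f (walkValue η L (flip {L + n} s))
      (walkValue η L (flip {L + n} s) (n + 1)) =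
      pathExp S n f (walkValue η L s) (moveBy η (!bit s (L + n)) (walkValue η L s n)) := by
    intro s
    rw [pathExp_congr S f (hflip s)]
    congr 1
    rw [walkValue, ← add_assoc, walk, bit_flip_of_mem s hn (Set.mem_singleton _)]
    exact congrArg _ (hflip s n le_rfl)
  have hJ' : ∀ s : Fin N → Bool, walkValue η L s (n + 1) =
      moveBy η (bit s (L + n)) (walkValue η L s n) := fun s => rfl
  have h2 : ∑ s : Fin N → Bool, pathExp S n f (walkValue η L s) (walkValue η L s (n + 1)) =
      2⁻¹ * ∑ s : Fin N → Bool, pathExp S n f (walkValue η L s) (walkValue η L s (n + 1)) +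
      2⁻¹ * ∑ s : Fin N → Bool, pathExp S n f (walkValue η L (flip {L + n} s))
        (walkValue η L (flip {L + n} s) (n + 1)) := by
    rw [sum_flip {L + n} fun s : Fin N → Bool =>
      pathExp S n f (walkValue η L s) (walkValue η L s (n + 1)), ← add_mul,
      ENNReal.inv_two_add_inv_two, one_mul]
  rw [h2, Finset.mul_sum, Finset.mul_sum, ← Finset.sum_add_distrib]
  refine Finset.sum_congr rfl fun s _ => ?_
  rw [hJ s, hJ' s]
  cases bit s (L + n)
  · rw [add_comm]; rfl
  · rfl

lemma measurable_lintegral_step (S : Seller) (B : Buyer) (n : ℕ) {f : History n × Round → ℝ≥0∞}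
    (hf : Measurable f) :
    Measurable fun h : History n => ∫⁻ v, ∫⁻ p, f (h, (v, p)) ∂(S.next n (observe n h))
      ∂(B.next n h) := by
  have : (fun h : History n => ∫⁻ v, ∫⁻ p, f (h, (v, p)) ∂(S.next n (observe n h))
      ∂(B.next n h)) = fun h => ∫⁻ x, f (h, x) ∂(step S B n h) := by
    funext h
    rw [step, Kernel.prod_apply, Kernel.comap_apply]
    exact (lintegral_prod _ (hf.comp measurable_prodMk_left).aemeasurable).symm
  rw [this]
  exact hf.lintegral_kernel_prod_right'

/-- The play against `walkBuyer` is a uniform mixture of the plays against the value paths. -/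
theorem lintegral_play_walkBuyer (S : Seller) (η : ℝ) {L N n : ℕ} (hn : L + n ≤ N)
    {f : History n → ℝ≥0∞} (hf : Measurable f) :
    ∫⁻ ω, f (frestrictLe n ω) ∂(play S (walkBuyer η L N)) =
      ((2 : ℝ≥0∞) ^ N)⁻¹ * ∑ s : Fin N → Bool,
        ∫⁻ q, f (attach (walkValue η L s) n q) ∂(pathLaw S (walkValue η L s) n) := by
  induction n with
  | zero =>
    have hm : Measurable fun x : Round => f (fun _ => x) := hf.comp (by fun_prop)
    have h0 : ∀ ω : ℕ → Round, frestrictLe (π := fun _ => Round) 0 ω = fun _ => ω 0 := by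
      intro ω
      funext i
      have := Finset.mem_Iic.1 i.2
      obtain ⟨i, hi⟩ := i
      obtain rfl : i = 0 := by simpa using hi
      rfl
    simp only [h0]
    rw [lintegral_play_zero S _ hm, walkBuyer, lintegral_finsetSum_measure, Finset.mul_sum]
    refine Finset.sum_congr rfl fun s _ => ?_
    have hm' : Measurable fun q => f (attach (walkValue η L s) 0 q) :=
      hf.comp (measurable_attach _ _)
    rw [lintegral_smul_measure, lintegral_dirac, smul_eq_mul, pathLaw,
      lintegral_map hm' (by fun_prop)]
    congr 1
    refine lintegral_congr fun p => ?_
    congr 1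
    funext i
    obtain ⟨i, hi⟩ := i
    obtain rfl : i = 0 := by simpa using hi
    rfl
  | succ n ih =>
    have hm : Measurable fun x : History n × Round => f (extend n x) :=
      hf.comp (measurable_extend n)
    have h1 := lintegral_play_succ S (walkBuyer η L N) n hm
    simp only [extend_frestrictLe] at h1
    rw [h1, ih (by lia) (measurable_lintegral_step S (walkBuyer η L N) n hm)]
    congr 1
    simp only [pathExp_self S hf]
    rw [← sum_pathExp_walkValue S η (by lia) f]
    refine Finset.sum_congr rfl fun s _ => ?_
    rw [← lintegral_coinKernel_pathExp S η hf]
    rfl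

lemma integral_roundLoss_walkBuyer (S : Seller) (η : ℝ) {L N n : ℕ} (hn : L + n ≤ N) :
    ∫ ω, roundLoss (ω n) ∂(play S (walkBuyer η L N)) =
      ((2 : ℝ) ^ N)⁻¹ * ∑ s : Fin N → Bool, pathLoss S (walkValue η L s) n := by
  have hm : Measurable fun h : History n => ENNReal.ofReal (roundLoss (h ⟨n, by simp⟩)) :=
    (measurable_roundLoss.comp (by fun_prop)).ennreal_ofReal
  have h := lintegral_play_walkBuyer S η hn hm
  rw [integral_eq_lintegral_of_nonneg_ae (Filter.Eventually.of_forall fun ω => roundLoss_nonneg _)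
    (measurable_roundLoss.comp (by fun_prop)).aestronglyMeasurable]
  have h2 : ∀ s : Fin N → Bool, pathLoss S (walkValue η L s) n =
      (∫⁻ q, ENNReal.ofReal (roundLoss (attach (walkValue η L s) n q ⟨n, by simp⟩))
        ∂(pathLaw S (walkValue η L s) n)).toReal := fun s =>
    integral_eq_lintegral_of_nonneg_ae (Filter.Eventually.of_forall fun ω => roundLoss_nonneg _)
      (integrable_roundLoss_path S _ n).aestronglyMeasurable
  have hfin : ∀ s : Fin N → Bool,
      ∫⁻ q, ENNReal.ofReal (roundLoss (attach (walkValue η L s) n q ⟨n, by simp⟩))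
        ∂(pathLaw S (walkValue η L s) n) ≠ ∞ := fun s =>
    ((lintegral_mono fun ω => ENNReal.ofReal_le_one.2 (roundLoss_le_one _)).trans_lt
      (by simp)).ne
  simp only [h2]
  rw [← ENNReal.toReal_sum fun s _ => hfin s]
  refine (congrArg ENNReal.toReal h).trans ?_
  rw [ENNReal.toReal_mul]
  simp

/-! ### Moments of sums of signs. -/

section Mean

variable {N : ℕ}

/-- The mean over all sequences of `N` bits. -/
def mean (f : (Fin N → Bool) → ℝ) : ℝ := ((2 : ℝ) ^ N)⁻¹ * ∑ s, f s

lemma mean_add (f g : (Fin N → Bool) → ℝ) : mean (fun s => f s + g s) = mean f + mean g := by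
  simp only [mean, Finset.sum_add_distrib, mul_add]

lemma mean_const_mul (c : ℝ) (f : (Fin N → Bool) → ℝ) :
    mean (fun s => c * f s) = c * mean f := by
  simp only [mean, ← Finset.mul_sum]
  ring

lemma mean_sub (f g : (Fin N → Bool) → ℝ) : mean (fun s => f s - g s) = mean f - mean g := by
  simp only [mean, Finset.sum_sub_distrib, mul_sub]

lemma mean_sum {ι : Type*} (A : Finset ι) (f : ι → (Fin N → Bool) → ℝ) :
    mean (fun s => ∑ i ∈ A, f i s) = ∑ i ∈ A, mean (f i) := by
  simp only [mean, ← Finset.mul_sum]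
  rw [Finset.sum_comm]

lemma mean_const (c : ℝ) : mean (fun _ : Fin N → Bool => c) = c := by
  rw [mean, Finset.sum_const, Finset.card_univ, Fintype.card_fun, Fintype.card_bool,
    Fintype.card_fin, nsmul_eq_mul]
  push_cast
  rw [← mul_assoc, inv_mul_cancel₀ (by positivity), one_mul]

lemma mean_mono {f g : (Fin N → Bool) → ℝ} (h : ∀ s, f s ≤ g s) : mean f ≤ mean g :=
  mul_le_mul_of_nonneg_left (Finset.sum_le_sum fun s _ => h s) (by positivity)

lemma mean_flip (A : Set ℕ) [DecidablePred (· ∈ A)] (f : (Fin N → Bool) → ℝ) :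
    mean (fun s => f (flip A s)) = mean f := by
  rw [mean, mean, sum_flip A f]

-- The martingale property: flipping the one bit on which `f` does not depend changes the sign of
-- the product.
open Classical in
lemma mean_mul_sgn_eq_zero {k : ℕ} (hk : k < N) {f : (Fin N → Bool) → ℝ}
    (hf : ∀ s, f (flip {k} s) = f s) : mean (fun s => f s * sgn (bit s k)) = 0 := by
  have h := mean_flip {k} fun s : Fin N → Bool => f s * sgn (bit s k)
  simp only [hf, bit_flip_of_mem _ hk (Set.mem_singleton k), sgn_not] at h
  have h2 : mean (fun s : Fin N → Bool => f s * -sgn (bit s k)) =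
      -1 * mean (fun s : Fin N → Bool => f s * sgn (bit s k)) := by
    rw [← mean_const_mul]
    congr 1
    funext s
    ring
  linarith

/-- The sum of the signs `a, …, a + n - 1`. -/
def signSum (s : Fin N → Bool) (a n : ℕ) : ℝ := ∑ i ∈ Finset.range n, sgn (bit s (a + i))

lemma signSum_succ (s : Fin N → Bool) (a n : ℕ) :
    signSum s a (n + 1) = signSum s a n + sgn (bit s (a + n)) := Finset.sum_range_succ _ _

lemma signSum_flip (A : Set ℕ) [DecidablePred (· ∈ A)] (s : Fin N → Bool) {a n : ℕ}
    (h : ∀ i < n, a + i ∉ A) : signSum (flip A s) a n = signSum s a n :=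
  Finset.sum_congr rfl fun i hi => by
    rw [bit_flip_of_notMem s (h i (Finset.mem_range.1 hi))]

lemma signSum_flip_of_mem (A : Set ℕ) [DecidablePred (· ∈ A)] (s : Fin N → Bool) {a n : ℕ}
    (hN : a + n ≤ N) (h : ∀ i < n, a + i ∈ A) : signSum (flip A s) a n = -signSum s a n := by
  rw [signSum, signSum, ← Finset.sum_neg_distrib]
  refine Finset.sum_congr rfl fun i hi => ?_
  have hi := Finset.mem_range.1 hi
  rw [bit_flip_of_mem s (by lia) (h i hi), sgn_not]

open Classical in
lemma mean_signSum_mul_sgn {a n : ℕ} (h : a + n < N) (F : ℝ → ℝ) :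
    mean (fun s : Fin N → Bool => F (signSum s a n) * sgn (bit s (a + n))) = 0 := by
  refine mean_mul_sgn_eq_zero h fun s => ?_
  rw [signSum_flip]
  intro i hi
  simp only [Set.mem_singleton_iff]
  lia

lemma mean_signSum_sq {a n : ℕ} (h : a + n ≤ N) :
    mean (fun s : Fin N → Bool => signSum s a n ^ 2) = n := by
  induction n with
  | zero => simp [signSum, mean_const]
  | succ n ih =>
    have h0 := mean_signSum_mul_sgn (N := N) (a := a) (n := n) (by lia) fun x => 2 * x
    have : (fun s : Fin N → Bool => signSum s a (n + 1) ^ 2) = fun s =>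
        (signSum s a n ^ 2 + 2 * signSum s a n * sgn (bit s (a + n))) + 1 := by
      funext s
      rw [signSum_succ]
      linear_combination sgn_sq (bit s (a + n))
    rw [this, mean_add, mean_add, h0, ih (by lia), mean_const]
    push_cast
    ring

lemma mean_signSum_pow_four {a n : ℕ} (h : a + n ≤ N) :
    mean (fun s : Fin N → Bool => signSum s a n ^ 4) ≤ 3 * (n : ℝ) ^ 2 := by
  induction n with
  | zero => simp [signSum, mean_const]
  | succ n ih =>
    have h0 := mean_signSum_mul_sgn (N := N) (a := a) (n := n) (by lia) fun x => 4 * x ^ 3 + 4 * x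
    have : (fun s : Fin N → Bool => signSum s a (n + 1) ^ 4) = fun s =>
        (signSum s a n ^ 4 + (4 * signSum s a n ^ 3 + 4 * signSum s a n) * sgn (bit s (a + n))) +
          (6 * signSum s a n ^ 2 + 1) := by
      funext s
      rw [signSum_succ]
      linear_combination (6 * signSum s a n ^ 2 + 4 * signSum s a n * sgn (bit s (a + n)) +
        sgn (bit s (a + n)) ^ 2 + 1) * sgn_sq (bit s (a + n))
    rw [this, mean_add, mean_add, h0, mean_add, mean_const, mean_const_mul,
      mean_signSum_sq (by lia)]
    have := ih (by lia)
    push_cast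
    nlinarith

end Mean

/-! ### Displacement of the walk and the loss in a window. -/

section Walk

variable {N : ℕ} {η : ℝ}

lemma walk_succ_of_le {s : Fin N → Bool} {n : ℕ} (h : 1 / 4 ≤ |(walk η s n : ℝ) - 1 / 2|) :
    walk η s (n + 1) = walk η s n := by
  rw [walk, moveBy, if_neg (not_lt.2 h)]

lemma walk_eq_of_le {s : Fin N → Bool} {m n : ℕ} (hmn : m ≤ n)
    (h : 1 / 4 ≤ |(walk η s m : ℝ) - 1 / 2|) : walk η s n = walk η s m := by
  induction n, hmn using Nat.le_induction with
  | base => rfl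
  | succ n _ ih => rw [walk_succ_of_le (by rwa [ih]), ih]

/-- A walk that has left the central interval is frozen outside, so being inside at time `M` means
that it was never stopped before. -/
lemma walk_eq_add_signSum (h0 : 0 ≤ η) (h1 : η ≤ 1 / 4) {s : Fin N → Bool} {M n : ℕ}
    (h : |(walk η s M : ℝ) - 1 / 2| < 1 / 4) (hn : n ≤ M) :
    (walk η s n : ℝ) = 1 / 2 + η * signSum s 0 n := by
  induction n with
  | zero => simp [walk, signSum]
  | succ n ih =>
    have hlt : |(walk η s n : ℝ) - 1 / 2| < 1 / 4 := by
      by_contra hcon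
      have hcon := not_lt.1 hcon
      rw [walk_eq_of_le (by lia : n ≤ M) hcon] at h
      linarith
    rw [walk, coe_moveBy h0 h1, if_pos hlt, ih (by lia), signSum_succ, zero_add]
    ring

lemma abs_walk_sub_le (h0 : 0 ≤ η) (h1 : η ≤ 1 / 4) (s : Fin N → Bool) (n : ℕ) :
    |(walk η s n : ℝ) - 1 / 2| ≤ 1 / 4 + η := by
  induction n with
  | zero =>
    simp only [walk, sub_self, abs_zero]
    linarith
  | succ n ih =>
    rw [walk, coe_moveBy h0 h1]
    split_ifs with h
    · rw [abs_lt] at h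
      rw [abs_le]
      cases bit s n <;> simp only [sgn] <;> norm_num <;> constructor <;> linarith
    · simpa using ih

open Classical in
lemma mean_walk_sub_sq_le (h0 : 0 ≤ η) (h1 : η ≤ 1 / 4) {n : ℕ} (hn : n ≤ N) :
    mean (fun s : Fin N → Bool => ((walk η s n : ℝ) - 1 / 2) ^ 2) ≤ n * η ^ 2 := by
  induction n with
  | zero => simp [walk, mean_const]
  | succ n ih =>
    let F : (Fin N → Bool) → ℝ := fun s =>
      if |(walk η s n : ℝ) - 1 / 2| < 1 / 4 then 2 * ((walk η s n : ℝ) - 1 / 2) * η else 0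
    have hz : mean (fun s => F s * sgn (bit s n)) = 0 := by
      refine mean_mul_sgn_eq_zero (by lia) fun s => ?_
      have : walk η (flip {n} s) n = walk η s n := walk_congr fun i hi =>
        bit_flip_of_notMem s (by simp only [Set.mem_singleton_iff]; lia)
      simp only [F, this]
    calc mean (fun s : Fin N → Bool => ((walk η s (n + 1) : ℝ) - 1 / 2) ^ 2)
        ≤ mean (fun s : Fin N → Bool =>
            (((walk η s n : ℝ) - 1 / 2) ^ 2 + F s * sgn (bit s n)) + η ^ 2) := by
          refine mean_mono fun s => ?_
          rw [walk, coe_moveBy h0 h1]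
          simp only [F]
          split_ifs
          · refine le_of_eq ?_
            linear_combination η ^ 2 * sgn_sq (bit s n)
          · nlinarith [sq_nonneg η]
      _ ≤ _ := by
          rw [mean_add, mean_add, hz, mean_const]
          have := ih (by lia)
          push_cast
          linarith

/-- The indicator of the event that the walk has left the central interval. -/
def exitInd (η : ℝ) (s : Fin N → Bool) : ℝ :=
  if |(walk η s N : ℝ) - 1 / 2| < 1 / 4 then 0 else 1

lemma exitInd_nonneg (s : Fin N → Bool) : 0 ≤ exitInd η s := by
  unfold exitInd; split_ifs <;> norm_num

/-- Chebyshev at the final time suffices, since an exit is permanent. -/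
lemma mean_exitInd_le (h0 : 0 ≤ η) (h1 : η ≤ 1 / 4) :
    mean (fun s : Fin N → Bool => exitInd η s) ≤ 16 * (N * η ^ 2) := by
  refine le_trans ?_ (mul_le_mul_of_nonneg_left (mean_walk_sub_sq_le h0 h1 le_rfl)
    (by norm_num : (0 : ℝ) ≤ 16))
  rw [← mean_const_mul]
  refine mean_mono fun s => ?_
  unfold exitInd
  split_ifs with h
  · positivity
  · rw [not_lt] at h
    rw [← sq_abs]
    nlinarith

/-- A polynomial minorant whose mean is controlled by the second and fourth moments; it touches `1`
at `y² = 3`. -/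
lemma two_thirds_le_min {y : ℝ} (hy : 0 ≤ y) :
    2 / 3 * (y ^ 2 - y ^ 4 / 6) ≤ min y 1 := by
  refine le_min ?_ ?_
  · rcases le_or_gt y 1 with h | h
    · nlinarith [pow_nonneg hy 4]
    · nlinarith [sq_nonneg (y ^ 2 - 3)]
  · nlinarith [sq_nonneg (y ^ 2 - 3)]

lemma le_min_abs_walkValue_sub (h0 : 0 ≤ η) (h1 : η ≤ 1 / 4) {L t : ℕ} (hL : 1 ≤ L)
    (ht : L + t ≤ N) [DecidablePred (· ∈ Set.Ico t (t + L))] (s : Fin N → Bool) :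
    2 * η * √L * (2 / 3 * (signSum s t L ^ 2 / L - signSum s t L ^ 4 / (6 * L ^ 2)) -
        exitInd η s - exitInd η (flip (Set.Ico t (t + L)) s)) ≤
      min |(walkValue η L s t : ℝ) - walkValue η L (flip (Set.Ico t (t + L)) s) t|
        (2 * η * √L) := by
  set s' := flip (Set.Ico t (t + L)) s with hs'
  have hL0 : (0 : ℝ) < L := by exact_mod_cast hL
  have hsq : √(L : ℝ) ^ 2 = L := Real.sq_sqrt hL0.le
  have hr0 : 0 < √(L : ℝ) := Real.sqrt_pos.2 hL0
  set y := |signSum s t L| / √L with hy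
  have hy0 : 0 ≤ y := by positivity
  have hy2 : y ^ 2 = signSum s t L ^ 2 / L := by rw [hy, div_pow, sq_abs, hsq]
  have hy4 : y ^ 4 / 6 = signSum s t L ^ 4 / (6 * L ^ 2) := by
    rw [show y ^ 4 = (y ^ 2) ^ 2 by ring, hy2]
    field_simp
  rw [← hy2, ← hy4]
  have hmin := two_thirds_le_min hy0
  have hD : 0 ≤ 2 * η * √(L : ℝ) := by positivity
  have hle1 := hmin.trans (min_le_right _ _)
  have hley := hmin.trans (min_le_left _ _)
  have hrhs : 0 ≤ min |(walkValue η L s t : ℝ) - walkValue η L s' t| (2 * η * √L) :=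
    le_min (abs_nonneg _) hD
  by_cases he : |(walk η s N : ℝ) - 1 / 2| < 1 / 4
  swap
  · have : exitInd η s = 1 := if_neg he
    have h2 := exitInd_nonneg (η := η) s'
    refine le_trans ?_ hrhs
    exact mul_nonpos_of_nonneg_of_nonpos hD (by linarith)
  by_cases he' : |(walk η s' N : ℝ) - 1 / 2| < 1 / 4
  swap
  · have : exitInd η s' = 1 := if_neg he'
    have h2 := exitInd_nonneg (η := η) s
    refine le_trans ?_ hrhs
    exact mul_nonpos_of_nonneg_of_nonpos hD (by linarith)
  have e1 : exitInd η s = 0 := if_pos he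
  have e2 : exitInd η s' = 0 := if_pos he'
  have hsplit : ∀ r : Fin N → Bool, signSum r 0 (L + t) = signSum r 0 t + signSum r t L := by
    intro r
    simp only [signSum, zero_add]
    rw [add_comm L t, Finset.sum_range_add]
  have hdiff : |(walkValue η L s t : ℝ) - walkValue η L s' t| = 2 * η * √L * y := by
    rw [walkValue, walkValue, walk_eq_add_signSum h0 h1 he ht, walk_eq_add_signSum h0 h1 he' ht,
      hsplit, hsplit, hs', signSum_flip, signSum_flip_of_mem]
    · have : (1 / 2 + η * (signSum s 0 t + signSum s t L) -
          (1 / 2 + η * (signSum s 0 t + -signSum s t L))) = 2 * η * signSum s t L := by ring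
      rw [this, abs_mul, abs_of_nonneg (by positivity : 0 ≤ 2 * η), hy]
      field_simp
    · lia
    · intro i hi
      exact ⟨by lia, by lia⟩
    · intro i hi hmem
      have := hmem.1
      lia
  rw [e1, e2, sub_zero, sub_zero, hdiff]
  refine le_min ?_ ?_
  · exact mul_le_mul_of_nonneg_left hley hD
  · exact mul_le_of_le_one_right hD hle1

/-- The normalized second moment is `1` and the fourth at most `3`, so the minorant has mean at
least `2/3 * (1 - 1/2) = 1/3`. The two exit events cost `1/8` each, which leaves `1/12`. -/
lemma le_mean_min_abs_walkValue_sub (h0 : 0 ≤ η) (h1 : η ≤ 1 / 4) {L t : ℕ} (hL : 1 ≤ L)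
    (ht : L + t ≤ N) [DecidablePred (· ∈ Set.Ico t (t + L))] (hN : 16 * (N * η ^ 2) ≤ 1 / 8) :
    2 * η * √L / 12 ≤ mean (fun s : Fin N → Bool =>
      min |(walkValue η L s t : ℝ) - walkValue η L (flip (Set.Ico t (t + L)) s) t|
        (2 * η * √L)) := by
  refine le_trans ?_ (mean_mono fun s => le_min_abs_walkValue_sub h0 h1 hL ht s)
  have hL0 : (0 : ℝ) < L := by exact_mod_cast hL
  have hsq := mean_signSum_sq (N := N) (a := t) (n := L) (by lia)
  have hfour := mean_signSum_pow_four (N := N) (a := t) (n := L) (by lia)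
  have hex := (mean_exitInd_le (N := N) h0 h1).trans hN
  have hA : mean (fun s : Fin N → Bool => signSum s t L ^ 2 / L) = 1 := by
    simp only [div_eq_inv_mul]
    rw [mean_const_mul, hsq, inv_mul_cancel₀ hL0.ne']
  have hB : mean (fun s : Fin N → Bool => signSum s t L ^ 4 / (6 * L ^ 2)) ≤ 1 / 2 := by
    simp only [div_eq_inv_mul]
    rw [mean_const_mul, inv_mul_le_iff₀ (by positivity)]
    linarith
  rw [mean_const_mul, mean_sub, mean_sub, mean_const_mul, mean_sub, hA,
    mean_flip _ (fun s : Fin N → Bool => exitInd η s), div_eq_mul_one_div]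
  exact mul_le_mul_of_nonneg_left (by linarith) (by positivity)

/-- The expected loss of round `t` and of the `L` rounds before. -/
lemma le_mean_pathLoss_window (S : Seller) (h0 : 0 ≤ η) (h1 : η ≤ 1 / 16) {L t : ℕ} (hL : 1 ≤ L)
    (ht : L + t ≤ N) (hN : 16 * (N * η ^ 2) ≤ 1 / 8) :
    2 * η * √L / 12 ≤ 2 * mean (fun s : Fin N → Bool => pathLoss S (walkValue η L s) t) +
      2 * η * √L * (12 * ∑ j ∈ (Finset.range (t + 1)).filter (fun j => t < L + j),
        mean (fun s : Fin N → Bool => pathLoss S (walkValue η L s) j)) := by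
  classical
  set D := 2 * η * √(L : ℝ) with hDdef
  have hD : 0 ≤ D := by positivity
  have h14 : η ≤ 1 / 4 := by linarith
  refine (le_mean_min_abs_walkValue_sub h0 h14 hL ht hN).trans ?_
  set e : (Fin N → Bool) → (Fin N → Bool) := flip (Set.Ico t (t + L)) with he
  have hover : ∀ (s : Fin N → Bool) (j : ℕ),
      overProb S (walkValue η L s) j ≤ 6 * pathLoss S (walkValue η L s) j := by
    intro s j
    have h2 := mul_overProb_le_pathLoss S (walkValue η L s) j
    have h3 := (abs_le.1 (abs_walk_sub_le h0 h14 s (L + j))).1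
    have h4 := overProb_nonneg S (walkValue η L s) j
    have h5 : 3 / 16 ≤ (walkValue η L s j : ℝ) := by unfold walkValue; linarith
    nlinarith
  calc mean (fun s => min |(walkValue η L s t : ℝ) - walkValue η L (e s) t| D)
      ≤ mean (fun s => (pathLoss S (walkValue η L s) t + pathLoss S (walkValue η L (e s)) t) +
          D * (6 * ∑ j ∈ (Finset.range (t + 1)).filter (fun j => t < L + j),
            (pathLoss S (walkValue η L s) j + pathLoss S (walkValue η L (e s)) j))) := by
        refine mean_mono fun s => ?_
        -- The gap is capped at `D` because it also multiplies the probability of detection.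
        set m := min |(walkValue η L s t : ℝ) - walkValue η L (e s) t| D with hm
        have hm0 : 0 ≤ m := le_min (abs_nonneg _) hD
        have h2 := le_pathLoss_add_pathLoss S (walkValue η L s) (walkValue η L (e s)) t hm0
          (min_le_left _ _)
        -- Round `j` uses the bits below `L + j`, and the flipped bits start at `t`.
        have hsub : (Finset.range (t + 1)).filter
            (fun j => walkValue η L s j ≠ walkValue η L (e s) j) ⊆
            (Finset.range (t + 1)).filter (fun j => t < L + j) := by
          intro j hj
          rw [Finset.mem_filter] at hj ⊢
          refine ⟨hj.1, ?_⟩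
          by_contra hcon
          refine hj.2 (walk_congr fun i hi => ?_)
          rw [he, bit_flip_of_notMem]
          intro hmem
          have := hmem.1
          lia
        have h3 : ∑ j ∈ (Finset.range (t + 1)).filter
            (fun j => walkValue η L s j ≠ walkValue η L (e s) j),
              (overProb S (walkValue η L s) j + overProb S (walkValue η L (e s)) j) ≤
            6 * ∑ j ∈ (Finset.range (t + 1)).filter (fun j => t < L + j),
              (pathLoss S (walkValue η L s) j + pathLoss S (walkValue η L (e s)) j) := by
          rw [Finset.mul_sum]
          refine (Finset.sum_le_sum_of_subset_of_nonneg hsub fun j _ _ =>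
            add_nonneg (overProb_nonneg _ _ _) (overProb_nonneg _ _ _)).trans ?_
          refine Finset.sum_le_sum fun j _ => ?_
          linarith [hover s j, hover (e s) j]
        have h4 : 0 ≤ 6 * ∑ j ∈ (Finset.range (t + 1)).filter (fun j => t < L + j),
              (pathLoss S (walkValue η L s) j + pathLoss S (walkValue η L (e s)) j) :=
          mul_nonneg (by norm_num) (Finset.sum_nonneg fun j _ =>
            add_nonneg (pathLoss_nonneg _ _ _) (pathLoss_nonneg _ _ _))
        have h5 := mul_le_mul_of_nonneg_left h3 hm0
        have h6 := mul_le_mul_of_nonneg_right (min_le_right _ _ : m ≤ D) h4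
        linarith
    _ = _ := by
        have hflip : ∀ j, mean (fun s => pathLoss S (walkValue η L (e s)) j) =
            mean (fun s : Fin N → Bool => pathLoss S (walkValue η L s) j) := fun j =>
          mean_flip (Set.Ico t (t + L)) fun s : Fin N → Bool => pathLoss S (walkValue η L s) j
        rw [mean_add, mean_add, mean_const_mul, mean_const_mul, mean_sum, hflip]
        simp only [mean_add, hflip, ← two_mul]
        rw [← Finset.mul_sum]
        ring

end Walk

/-! ### Summation over the rounds and the lower bound. -/

lemma sum_sum_window_le {x : ℕ → ℝ} (hx : ∀ j, 0 ≤ x j) (L T : ℕ) :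
    ∑ t ∈ Finset.range T, ∑ j ∈ (Finset.range (t + 1)).filter (fun j => t < L + j), x j ≤
      L * ∑ j ∈ Finset.range T, x j := by
  rw [Finset.sum_comm' (t' := Finset.range T)
    (s' := fun j => (Finset.range T).filter fun t => j ≤ t ∧ t < L + j)]
  · rw [Finset.mul_sum]
    refine Finset.sum_le_sum fun j _ => ?_
    rw [Finset.sum_const, nsmul_eq_mul]
    refine mul_le_mul_of_nonneg_right ?_ (hx j)
    have hsub : (Finset.range T).filter (fun t => j ≤ t ∧ t < L + j) ⊆ Finset.Ico j (L + j) := by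
      intro t ht
      exact Finset.mem_Ico.2 (Finset.mem_filter.1 ht).2
    have := Finset.card_le_card hsub
    rw [Nat.card_Ico, Nat.add_sub_cancel] at this
    exact_mod_cast this
  · intro t j
    simp only [Finset.mem_range, Finset.mem_filter]
    lia

/-- The loss of any seller against the walk. -/
theorem le_revenueLoss_walkBuyer (S : Seller) {η : ℝ} (h0 : 0 ≤ η) (h1 : η ≤ 1 / 16) {L T : ℕ}
    (hL : 1 ≤ L) (hT : 1 ≤ T) (hN : 16 * ((L + T : ℕ) * η ^ 2) ≤ 1 / 8)
    (hLη : L * (2 * η * √L) ≤ 1 / 8) :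
    2 * η * √L / 42 ≤ revenueLoss S (walkBuyer η L (L + T)) T := by
  have hT0 : (0 : ℝ) < T := by exact_mod_cast hT
  set x : ℕ → ℝ := fun t =>
    mean (fun s : Fin (L + T) → Bool => pathLoss S (walkValue η L s) t) with hx
  have hx0 : ∀ j, 0 ≤ x j := fun j =>
    (mean_const (N := L + T) 0).symm.le.trans (mean_mono fun s => pathLoss_nonneg _ _ _)
  set D := 2 * η * √(L : ℝ) with hD
  have hD0 : 0 ≤ D := by positivity
  have hsum : ∑ _t ∈ Finset.range T, D / 12 ≤ ∑ t ∈ Finset.range T, (2 * x t +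
      D * (12 * ∑ j ∈ (Finset.range (t + 1)).filter (fun j => t < L + j), x j)) := by
    refine Finset.sum_le_sum fun t ht => ?_
    have := Finset.mem_range.1 ht
    exact le_mean_pathLoss_window S h0 h1 hL (by lia) hN
  rw [Finset.sum_const, Finset.card_range, nsmul_eq_mul, Finset.sum_add_distrib,
    ← Finset.mul_sum, ← Finset.mul_sum, ← Finset.mul_sum] at hsum
  have hX0 : 0 ≤ ∑ j ∈ Finset.range T, x j := Finset.sum_nonneg fun j _ => hx0 j
  have hw := mul_le_mul_of_nonneg_left (sum_sum_window_le hx0 L T) hD0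
  have hw2 := mul_le_mul_of_nonneg_right hLη hX0
  rw [revenueLoss_eq_sum, Finset.sum_congr rfl fun t ht =>
    integral_roundLoss_walkBuyer S η (L := L) (N := L + T) (n := t)
      (by have := Finset.mem_range.1 ht; lia)]
  change D / 42 ≤ 1 / (T : ℝ) * ∑ t ∈ Finset.range T, x t
  rw [one_div, le_inv_mul_iff₀ hT0]
  -- With `X` the total loss, `T * D / 12 ≤ 2 X + 12 L D X ≤ (7/2) X`, hence the constant `42`.
  linarith

theorem exists_buyer_le_revenueLoss {T : ℕ} (hT : 1 ≤ T) {ε : ℝ} (hε : 0 < ε) (hε1 : ε ≤ 1)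
    (hTε : (T : ℝ) * ε ^ 2 ≤ 1) (S : Seller) :
    ∃ B : Buyer, B.IsStochastic ε ∧ 1 / 672 * ε ^ (2 / 3 : ℝ) ≤ revenueLoss S B T := by
  set a := ε ^ (1 / 3 : ℝ) with ha
  have ha0 : 0 < a := Real.rpow_pos_of_pos hε _
  have ha1 : a ≤ 1 := Real.rpow_le_one hε.le hε1 (by norm_num)
  have ha3 : a ^ 3 = ε := by
    rw [ha, ← Real.rpow_natCast, ← Real.rpow_mul hε.le]
    norm_num
  have ha2 : ε ^ (2 / 3 : ℝ) = a ^ 2 := by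
    rw [ha, ← Real.rpow_natCast, ← Real.rpow_mul hε.le]
    norm_num
  rw [ha2]
  -- The longest window, up to constants, for which `L * D` stays bounded when `η` is of order `ε`.
  set L := ⌊1 / a ^ 2⌋₊ with hLdef
  have hone : 1 ≤ 1 / a ^ 2 := by
    rw [le_div_iff₀ (by positivity)]
    nlinarith
  have hL : 1 ≤ L := Nat.le_floor (by simpa using hone)
  have hL1 : (1 : ℝ) ≤ L := by exact_mod_cast hL
  have hLle : (L : ℝ) ≤ 1 / a ^ 2 := Nat.floor_le (by positivity)
  have hLlt : 1 / a ^ 2 < (L : ℝ) + 1 := Nat.lt_floor_add_one _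
  have hsqrt_le : √(L : ℝ) ≤ 1 / a := by
    refine Real.sqrt_le_iff.2 ⟨by positivity, ?_⟩
    rw [div_pow, one_pow]
    exact hLle
  have hle_sqrt : 1 / (2 * a) ≤ √(L : ℝ) := by
    refine Real.le_sqrt_of_sq_le ?_
    have : (1 / (2 * a)) ^ 2 = 1 / a ^ 2 / 4 := by
      field_simp
      norm_num
    rw [this]
    linarith
  -- Since `(L + T) * ε² ≤ 2`, the factor `1/16` makes the exit bound exactly `1/8`.
  set η := a ^ 3 / 16 with hη
  have hη0 : 0 ≤ η := by positivity
  have hη1 : η ≤ 1 / 16 := by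
    have : a ^ 3 ≤ 1 := pow_le_one₀ ha0.le ha1
    rw [hη]
    linarith
  have hDle : 2 * η * √(L : ℝ) ≤ a ^ 2 / 8 := by
    calc 2 * η * √(L : ℝ) ≤ 2 * η * (1 / a) := by gcongr
      _ = a ^ 2 / 8 := by
        rw [hη]
        field_simp
        norm_num
  have hDge : a ^ 2 / 16 ≤ 2 * η * √(L : ℝ) := by
    calc a ^ 2 / 16 = 2 * η * (1 / (2 * a)) := by
          rw [hη]
          field_simp
      _ ≤ _ := by gcongr
  have hLη : L * (2 * η * √(L : ℝ)) ≤ 1 / 8 := by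
    calc L * (2 * η * √(L : ℝ)) ≤ 1 / a ^ 2 * (a ^ 2 / 8) := by gcongr
      _ = 1 / 8 := by field_simp
  have hN : 16 * ((L + T : ℕ) * η ^ 2) ≤ 1 / 8 := by
    have h1 : η ^ 2 = ε ^ 2 / 256 := by rw [hη, ha3]; ring
    have h2 : (L : ℝ) * ε ^ 2 ≤ 1 := by
      calc (L : ℝ) * ε ^ 2 ≤ 1 / a ^ 2 * ε ^ 2 := by gcongr
        _ = a ^ 4 := by
          rw [← ha3]
          field_simp
        _ ≤ 1 := pow_le_one₀ ha0.le ha1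
    rw [h1]
    push_cast
    linarith
  refine ⟨walkBuyer η L (L + T), isStochastic_walkBuyer hη0 (by linarith) ?_ L (L + T), ?_⟩
  · rw [hη, ha3]
    linarith
  · refine le_trans ?_ (le_revenueLoss_walkBuyer S hη0 hη1 hL hT hN hLη)
    linarith

end OnlinePricing

end

theorem mainTheorem9 :
    (∃ (A : ℕ → OnlinePricing.Seller) (C : ℝ) (k : ℕ),
      ∀ (T : ℕ), 1 ≤ T → ∀ (ε : ℝ), 0 < ε → ε ≤ 1 →
        ∀ (B : OnlinePricing.Buyer), B.IsStochastic ε →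
          OnlinePricing.revenueLoss (A T) B T ≤
            C * ε ^ (2 / 3 : ℝ) * (1 + Real.log (1 / ε)) ^ k + C * (T : ℝ) ^ (-(1 / 3) : ℝ)) ∧
    (∃ c : ℝ, 0 < c ∧
      ∀ (T : ℕ), 1 ≤ T → ∀ (ε : ℝ), 0 < ε → ε ≤ 1 → (T : ℝ) * ε ^ 2 ≤ 1 →
        ∀ (S : OnlinePricing.Seller), ∃ B : OnlinePricing.Buyer, B.IsStochastic ε ∧
          c * ε ^ (2 / 3 : ℝ) ≤ OnlinePricing.revenueLoss S B T) := by
  refine ⟨⟨fun _ => OnlinePricing.phaseSeller, 149, 0, fun T hT ε hε hε1 B hB => ?_⟩,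
    1 / 672, by norm_num, fun T hT ε hε hε1 hTε S =>
      OnlinePricing.exists_buyer_le_revenueLoss hT hε hε1 hTε S⟩
  rw [pow_zero, mul_one]
  exact OnlinePricing.revenueLoss_phaseSeller_le_rpow hB hε hε1 hT
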